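/- **Setting.** A roommates instance with incomplete lists consists of agents $N=\{1,\dots,n\}$, where each agent $i$ has a strict preference order $\succ_i$ over a subset of $N\setminus\{i\}$, the agents acceptable to $i$. Let $E$ be the set of pairs of agents that are acceptable to each other. A matching $M$ is a set of pairwise disjoint pairs in $E$; $M(i)$ is the partner of $i$, and $M(i)=i$ if $i$ is unmatched. Every agent $i$ prefers all acceptable agents to being unmatched, i.e. to $i$ itself. Agent $i$ prefers $M'$ to $M$ if $M'(i)\succ_i M(i)$. For real $k$, a matching $M$ is $k$-stable if there is no other matching $M'$ with $|\{i\in N : M'(i)\succ_i M(i)\}|\ge k$. A stable partition is a permutation $\pi$ of $N$ such that for each $i\in N$: (0) if $\pi(i)\ne i$ then $\{i,\pi(i)\}\in E$; (1) if $\pi(i)\neq\pi^{-1}(i)$ then $\pi(i)\succ_i\pi^{-1}(i)$; (2) for each $j$ with $\{i,j\}\in E$, if $\pi(i)=i$ or $j\succ_i\pi^{-1}(i)$, then $\pi^{-1}(j)=i$ or $\pi^{-1}(j)\succ_j i$. Below, an odd cycle is a cycle of $\pi$ of odd length at least three, and $x$ is the number of odd cycles. Given a stable partition $\pi$ and a set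 $D$ containing exactly one vertex of each odd cycle, we say that a matching $M$ is obtained from $(\pi,D)$ if it uses only pairs $\{i,\pi(i)\}$, leaves the vertices of $D$ and the fixed points of $\pi$ unmatched, and matches all other agents; that is, $M$ is a perfect matching of each component, other than single vertices, that remains of the cycles of $\pi$ after deleting $D$. **Theorem.** In the roommates model with incomplete lists: 1. For every instance and every real $c>\frac56$ there is a $cn$-stable matching. 2. Every instance has a stable partition $\pi$. For every stable partition $\pi$ there is a set $D$ as above, and for every such $D$ there is a matching obtained from $(\pi,D)$. For every matching $M$ obtained from $(\pi,D)$ and every matching $M'$, the number of agents who prefer $M'$ to $M$ is at most $\frac n2+x$, and $\frac n2+x\le\frac56 n$. Hence $M$ is $cn$-stable for every $c>\frac56$. 3. There is a single algorithm that, given the preference lists of any instance, outputs in time polynomial in $n$ a matching $M$ that is obtained from $(\pi,D)$ for some stable partition $\pi$ and some set $D$ as above; this $M$ is $cn$-stable for all $c>\frac56$ simultaneously. (Time is counted in steps of a random access machine with unit-cost addition, subtraction, test for zero and memory access.) -/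

import Mathlib

/-! ## The roommates model with incomplete lists -/

/-- A roommates instance with agents `0, …, n - 1`: every agent has a strictly ordered, possibly
incomplete list of the other agents, the most preferred one first. -/
structure Roommates (n : ℕ) where
  pref : Fin n → List (Fin n)
  nodup : ∀ i, (pref i).Nodup
  irrefl : ∀ i, i ∉ pref i

namespace Roommates

variable {n : ℕ}

/-- Edges of the acceptability graph: each of the two agents is acceptable to the other. -/
def Edge (I : Roommates n) (i j : Fin n) : Prop :=
  j ∈ I.pref i ∧ i ∈ I.pref j

/-- Agent `i` strictly prefers `j` to `k`. Agents that are not on the list of `i` have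
`idxOf` equal to the length of the list, so they come after all acceptable agents and are not
compared with each other. This applies to `i` itself, and "`i` is assigned to `i`" means
"`i` is unmatched". -/
def Prefers (I : Roommates n) (i j k : Fin n) : Prop :=
  (I.pref i).idxOf j < (I.pref i).idxOf k

instance (I : Roommates n) (i j k : Fin n) : Decidable (I.Prefers i j k) :=
  inferInstanceAs (Decidable (_ < _))

/-- A matching, given by the partner of every agent; `partner i = i` says that `i` is unmatched. -/
@[ext]
structure Matching (I : Roommates n) where
  partner : Fin n → Fin n
  invol : ∀ i, partner (partner i) = i
  edge : ∀ i, partner i ≠ i → I.Edge i (partner i)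

/-- The set of agents who prefer `M'` to `M`. -/
def improving (I : Roommates n) (M M' : I.Matching) : Finset (Fin n) :=
  Finset.univ.filter fun i => I.Prefers i (M'.partner i) (M.partner i)

/-- `M` is `k`-stable: no other matching is preferred to `M` by at least `k` agents. -/
def IsKStable (I : Roommates n) (k : ℝ) (M : I.Matching) : Prop :=
  ¬ ∃ M' : I.Matching, M' ≠ M ∧ k ≤ ((I.improving M M').card : ℝ)

/-- Stable partitions. In `stable`, the conclusion says that `j` weakly prefers `π⁻¹ j` to `i`. -/
structure IsStablePartition (I : Roommates n) (π : Equiv.Perm (Fin n)) : Prop where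
  edge : ∀ i, π i ≠ i → I.Edge i (π i)
  prefers : ∀ i, π i ≠ π⁻¹ i → I.Prefers i (π i) (π⁻¹ i)
  stable : ∀ i j, I.Edge i j → (π i = i ∨ I.Prefers i j (π⁻¹ i)) →
    (π⁻¹ j = i ∨ I.Prefers j (π⁻¹ j) i)

/-- The cycles of `π` of odd length at least three (`cycleFactorsFinset` does not list
fixed points). -/
def oddCycles (π : Equiv.Perm (Fin n)) : Finset (Equiv.Perm (Fin n)) :=
  π.cycleFactorsFinset.filter fun σ => Odd σ.support.card

/-- `D` consists of exactly one vertex of every odd cycle of `π` of length at least three. -/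
def PicksOnePerOddCycle (π : Equiv.Perm (Fin n)) (D : Finset (Fin n)) : Prop :=
  (∀ i ∈ D, ∃ σ ∈ oddCycles π, i ∈ σ.support) ∧
    ∀ σ ∈ oddCycles π, ∃! i, i ∈ D ∧ i ∈ σ.support

/-- `M` consists of a perfect matching of each component, other than the single vertices, of the
graph that is left of the cycles of `π` when the vertices in `D` are deleted. -/
structure IsObtainedFrom (I : Roommates n) (π : Equiv.Perm (Fin n)) (D : Finset (Fin n))
    (M : I.Matching) : Prop where
  along : ∀ i, M.partner i ≠ i → M.partner i = π i ∨ M.partner i = π⁻¹ i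
  deleted : ∀ i ∈ D, M.partner i = i
  perfect : ∀ i, i ∉ D → π i ≠ i → M.partner i ≠ i

end Roommates

/-! ## Random access machines

Programs of a random access machine with natural-number variables and arrays. The arithmetic
operations are addition and truncated subtraction. All operations have unit cost; there is
no multiplication, so this is the usual unit-cost model, polynomially equivalent to Turing
machines. -/

namespace RAM

/-- The memory: variable `x` holds `var x`, and cell `k` of array `a` holds `arr a k`. -/
structure State where
  var : ℕ → ℕ
  arr : ℕ → ℕ → ℕ

inductive Expr where
  | const (k : ℕ)
  | var (x : ℕ)
  | read (a : ℕ) (e : Expr)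
  | add (e f : Expr)
  | sub (e f : Expr)

def Expr.eval (s : State) : Expr → ℕ
  | .const k => k
  | .var x => s.var x
  | .read a e => s.arr a (e.eval s)
  | .add e f => e.eval s + f.eval s
  | .sub e f => e.eval s - f.eval s

/-- The number of operations performed in an evaluation. -/
def Expr.cost : Expr → ℕ
  | .const _ => 1
  | .var _ => 1
  | .read _ e => e.cost + 1
  | .add e f => e.cost + f.cost + 1
  | .sub e f => e.cost + f.cost + 1

inductive Prog where
  | skip
  | assign (x : ℕ) (e : Expr)
  | write (a : ℕ) (e f : Expr)
  | seq (p q : Prog)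
  | ite (e : Expr) (p q : Prog)
  | loop (e : Expr) (p : Prog)

def State.setVar (s : State) (x v : ℕ) : State :=
  { s with var := Function.update s.var x v }

def State.setArr (s : State) (a k v : ℕ) : State :=
  { s with arr := Function.update s.arr a (Function.update (s.arr a) k v) }

/-- `Exec p s t s'`: the program `p`, started in state `s`, halts after `t` steps in state `s'`.
A test succeeds if the value is not zero; `loop e p` repeats `p` while `e` succeeds. -/
inductive Exec : Prog → State → ℕ → State → Prop
  | skip (s : State) : Exec .skip s 1 s
  | assign (s : State) (x : ℕ) (e : Expr) :
      Exec (.assign x e) s (e.cost + 1) (s.setVar x (e.eval s))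
  | write (s : State) (a : ℕ) (e f : Expr) :
      Exec (.write a e f) s (e.cost + f.cost + 1) (s.setArr a (e.eval s) (f.eval s))
  | seq {p q : Prog} {s s' s'' : State} {t t' : ℕ} :
      Exec p s t s' → Exec q s' t' s'' → Exec (.seq p q) s (t + t') s''
  | ite_true {e : Expr} {p q : Prog} {s s' : State} {t : ℕ} :
      e.eval s ≠ 0 → Exec p s t s' → Exec (.ite e p q) s (e.cost + 1 + t) s'
  | ite_false {e : Expr} {p q : Prog} {s s' : State} {t : ℕ} :
      e.eval s = 0 → Exec q s t s' → Exec (.ite e p q) s (e.cost + 1 + t) s'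
  | loop_done {e : Expr} {p : Prog} {s : State} :
      e.eval s = 0 → Exec (.loop e p) s (e.cost + 1) s
  | loop_step {e : Expr} {p : Prog} {s s' s'' : State} {t t' : ℕ} :
      e.eval s ≠ 0 → Exec p s t s' → Exec (.loop e p) s' t' s'' →
        Exec (.loop e p) s (e.cost + 1 + t + t') s''

end RAM

namespace Roommates

variable {n : ℕ}

/-- Cell `i * n + r` of the input table: one plus the agent in position `r` (from `0`) of the list
of agent `i`, and `0` if that list has no such position or there is no agent `i`. -/
def inputCell (I : Roommates n) (k : ℕ) : ℕ :=
  if h : k / n < n then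
    match (I.pref ⟨k / n, h⟩)[k % n]? with
    | some j => (j : ℕ) + 1
    | none => 0
  else 0

/-- The initial memory: `n` in variable `0`, the table of preference lists in array `0`, and `0`
everywhere else. -/
def inputState (I : Roommates n) : RAM.State where
  var x := if x = 0 then n else 0
  arr a k := if a = 0 then I.inputCell k else 0

/-- The final memory describes `M`: cell `i` of array `1` is the partner of agent `i`
(and is `i` if `i` is unmatched). -/
def Outputs {I : Roommates n} (s : RAM.State) (M : I.Matching) : Prop :=
  ∀ i : Fin n, s.arr 1 i = (M.partner i : ℕ)

end Roommates

/-! ### Ranks, semistable permutations and second choices. -/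

namespace Roommates

variable {n : ℕ}

/-! The bound. In a matching `M` obtained from `(π, D)`, an agent outside `D` is at least as well
off as with its predecessor under `π`. If such an agent `i` improves in `M'`, it prefers its new
partner `j` to its predecessor, so stability of `π` makes `j` weakly prefer its own predecessor to
`i`. Hence the improving agents outside `D` and their partners in `M'` are disjoint sets of equal
size, and at most `n/2` agents outside `D` improve (`IsObtainedFrom.card_improving_le`). The agents
in `D` add at most `x`, and `x ≤ n/3` because odd cycles have at least three vertices. The matching
itself comes from cutting every cycle into a path and pairing up along it, with the vertex of `D`
last on an odd path (`IsCut.isObtainedFrom`).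

Stable partitions. Starting from the identity, one keeps a permutation `σ` that is semistable:
nobody prefers predecessor to successor, and anyone whom `i` prefers to its successor has a
predecessor at least as good as `i`. Let `s x` be the first agent after the successor of `x` who
would take `x` instead of its own predecessor. If `x` never prefers `s x` to its predecessor, `σ` is
a stable partition (`IsSemistable.isStablePartition`). Otherwise iterating `x ↦ σ⁻¹ (s x)` from a
violating `x` runs into a cycle, and replacing `σ` by `s` on it gives a semistable permutation again
(`IsRotation.isSemistable`). The danger is an orbit on which `s = σ⁻¹` throughout, whose cycle would
simply be reversed; a walk from a violating vertex never meets one (`IsSettled.of_step`), and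
nothing else can go wrong (`IsRotation.rank_le`). Successors only get worse, so the sum of their
ranks increases with every elimination; it is at most `n²`, which bounds the number of eliminations.

The algorithm carries out exactly these steps with counting loops only. Existence of stable
partitions is read off from its correctness (`run_algorithm`), and the polynomial running time from
the syntax of the program (`exec_compile`). -/

lemma perm_apply_inv_self (σ : Equiv.Perm (Fin n)) (x : Fin n) : σ (σ⁻¹ x) = x := by simp

lemma perm_inv_apply_self (σ : Equiv.Perm (Fin n)) (x : Fin n) : σ⁻¹ (σ x) = x := by simp

/-- The position of `j`, counted from one, on the list of `i`, and `n + 1` if `j` is not on it. -/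
def rank (I : Roommates n) (i j : Fin n) : ℕ :=
  if j ∈ I.pref i then (I.pref i).idxOf j + 1 else n + 1

lemma length_pref_le (I : Roommates n) (i : Fin n) : (I.pref i).length ≤ n := by
  simpa using (I.nodup i).length_le_card

lemma rank_pos (I : Roommates n) (i j : Fin n) : 0 < I.rank i j := by
  unfold rank; split_ifs <;> omega

lemma rank_le_iff (I : Roommates n) {i j : Fin n} : I.rank i j ≤ n ↔ j ∈ I.pref i := by
  unfold rank
  split_ifs with h
  · have := List.idxOf_lt_length_of_mem h
    have := I.length_pref_le i
    simp only [h, iff_true]; omega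
  · simp [h]

lemma rank_le (I : Roommates n) (i j : Fin n) : I.rank i j ≤ n + 1 := by
  by_cases h : j ∈ I.pref i
  · have := I.rank_le_iff.2 h; omega
  · simp [rank, h]

lemma rank_self (I : Roommates n) (i : Fin n) : I.rank i i = n + 1 := by
  simp [rank, I.irrefl i]

lemma eq_of_rank_eq (I : Roommates n) {i j k : Fin n} (hj : I.rank i j ≤ n)
    (h : I.rank i j = I.rank i k) : j = k := by
  have h1 := I.rank_le_iff.1 hj
  have h2 := I.rank_le_iff.1 (h ▸ hj)
  simp only [rank, h1, h2, if_true, Nat.add_right_cancel_iff] at h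
  exact (List.idxOf_inj h1).1 h

lemma prefers_iff (I : Roommates n) {i j k : Fin n} :
    I.Prefers i j k ↔ I.rank i j < I.rank i k := by
  have hl := I.length_pref_le i
  unfold Prefers rank
  split_ifs with h1 h2 h2
  · omega
  · have := List.idxOf_lt_length_of_mem h1
    rw [List.idxOf_eq_length h2]; omega
  · have := List.idxOf_lt_length_of_mem h2
    rw [List.idxOf_eq_length h1]; omega
  · rw [List.idxOf_eq_length h1, List.idxOf_eq_length h2]; omega

lemma edge_iff (I : Roommates n) {i j : Fin n} :
    I.Edge i j ↔ I.rank i j ≤ n ∧ I.rank j i ≤ n := by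
  simp [Edge, rank_le_iff]

lemma Edge.symm {I : Roommates n} {i j : Fin n} (h : I.Edge i j) : I.Edge j i := And.symm h

lemma Edge.ne {I : Roommates n} {i j : Fin n} (h : I.Edge i j) : i ≠ j := by
  rintro rfl; exact I.irrefl _ h.1

/-- The rank of the successor of `i`, where a fixed point counts as better than everybody. -/
def top (I : Roommates n) (σ : Equiv.Perm (Fin n)) (i : Fin n) : ℕ :=
  if σ i = i then 0 else I.rank i (σ i)

/-- The rank of the predecessor of `i`. -/
def bot (I : Roommates n) (σ : Equiv.Perm (Fin n)) (i : Fin n) : ℕ :=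
  I.rank i (σ⁻¹ i)

/-- The permutations that are reached from the identity by eliminating rotations. -/
structure IsSemistable (I : Roommates n) (σ : Equiv.Perm (Fin n)) : Prop where
  edge : ∀ i, σ i ≠ i → I.Edge i (σ i)
  top_le : ∀ i, I.top σ i ≤ I.bot σ i
  blocked : ∀ i j, I.Edge i j → I.rank i j < I.top σ i → I.bot σ j ≤ I.rank j i

/-- `j` comes after the successor of `x` on the list of `x` and prefers `x` to its own
predecessor. -/
def IsCand (I : Roommates n) (σ : Equiv.Perm (Fin n)) (x j : Fin n) : Prop :=
  I.top σ x < I.rank x j ∧ I.rank x j ≤ n ∧ I.rank j x < I.bot σ j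

/-- `q` is the best candidate of `x`, or `x` itself if there are no candidates. -/
structure IsSecond (I : Roommates n) (σ : Equiv.Perm (Fin n)) (x q : Fin n) : Prop where
  cand : I.IsCand σ x q ∨ q = x
  le : ∀ j, I.IsCand σ x j → I.rank x q ≤ I.rank x j

/-- Counting a fixed point as better than everybody makes all conditions vacuous here. -/
lemma isSemistable_one (I : Roommates n) : I.IsSemistable 1 where
  edge i h := absurd rfl h
  top_le i := by simp [top]
  blocked i j _ h := by simp [top] at h

section

variable {I : Roommates n} {σ : Equiv.Perm (Fin n)} {s : Fin n → Fin n}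

lemma bot_le (x : Fin n) : I.bot σ x ≤ n + 1 := I.rank_le _ _

lemma top_of_ne {x : Fin n} (h : σ x ≠ x) : I.top σ x = I.rank x (σ x) := if_neg h

lemma inv_apply_ne {x : Fin n} (h : σ x ≠ x) : σ⁻¹ x ≠ x := by
  intro h'
  rw [Equiv.Perm.inv_eq_iff_eq] at h'
  exact h h'.symm

lemma IsSemistable.edge_inv (hσ : I.IsSemistable σ) {x : Fin n} (h : σ x ≠ x) :
    I.Edge x (σ⁻¹ x) := by
  have := hσ.edge (σ⁻¹ x)
  rw [perm_apply_inv_self] at this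
  exact (this (inv_apply_ne h).symm).symm

lemma IsSemistable.bot_le_of_ne (hσ : I.IsSemistable σ) {x : Fin n} (h : σ x ≠ x) :
    I.bot σ x ≤ n := (I.edge_iff.1 (hσ.edge_inv h)).1

lemma bot_of_fixed {x : Fin n} (h : σ x = x) : I.bot σ x = n + 1 := by
  have : σ⁻¹ x = x := by rw [Equiv.Perm.inv_eq_iff_eq]; exact h.symm
  rw [bot, this, rank_self]

lemma IsSemistable.top_le_card (hσ : I.IsSemistable σ) (x : Fin n) : I.top σ x ≤ n := by
  by_cases h : σ x = x
  · simp [top, h]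
  · rw [top_of_ne h]; exact (I.edge_iff.1 (hσ.edge x h)).1

/-- Preferences are strict, so a vertex with no gap between successor and predecessor lies on a
cycle of length two. The other vertices, those with `top < bot`, are called active below. -/
lemma IsSemistable.apply_eq_inv (hσ : I.IsSemistable σ) {x : Fin n}
    (h : I.bot σ x ≤ I.top σ x) : σ x ≠ x ∧ σ x = σ⁻¹ x := by
  have hx : σ x ≠ x := by
    intro hx
    simp only [top, hx, if_true, bot] at h
    have := I.rank_pos x (σ⁻¹ x)
    omega
  refine ⟨hx, I.eq_of_rank_eq (I.edge_iff.1 (hσ.edge x hx)).1 ?_⟩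
  have := hσ.top_le x
  rw [top_of_ne hx] at h this
  exact le_antisymm this h

/-- An inactive vertex is on a 2-cycle, and then its successor is inactive too. -/
lemma IsSemistable.top_lt_bot_of_apply (hσ : I.IsSemistable σ) {x : Fin n}
    (h : I.top σ (σ x) < I.bot σ (σ x)) : I.top σ x < I.bot σ x := by
  by_contra! hx
  obtain ⟨h1, h2⟩ := hσ.apply_eq_inv hx
  have h3 : σ (σ x) = x := by rw [h2]; simp
  rw [top_of_ne (by rw [h3]; exact h1.symm), bot, h3] at h
  simp at h

/-- The predecessor of `x` has `x` as successor, which it strictly prefers to its own predecessor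
unless the two form a 2-cycle. So the second of an active vertex never comes after its predecessor.
-/
lemma IsSemistable.isCand_inv (hσ : I.IsSemistable σ) {x : Fin n}
    (h : I.top σ x < I.bot σ x) (hx : σ x ≠ x) : I.IsCand σ x (σ⁻¹ x) := by
  refine ⟨h, hσ.bot_le_of_ne hx, ?_⟩
  have h0 : σ (σ⁻¹ x) = x := by simp
  have hne : σ (σ⁻¹ x) ≠ σ⁻¹ x := by rw [h0]; exact (inv_apply_ne hx).symm
  have h1 := top_of_ne (I := I) hne
  rw [h0] at h1
  rw [← h1]
  by_contra! h2
  obtain ⟨-, h3⟩ := hσ.apply_eq_inv h2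
  rw [h0, Equiv.Perm.eq_inv_iff_eq] at h3
  rw [top_of_ne hx, bot, h3] at h
  exact lt_irrefl _ h

lemma IsSecond.isCand {x q : Fin n} (h : I.IsSecond σ x q) (hq : q ≠ x) : I.IsCand σ x q :=
  h.cand.resolve_right hq

lemma IsSecond.rank_le_bot (hσ : I.IsSemistable σ) {x q : Fin n} (h : I.IsSecond σ x q)
    (hx : I.top σ x < I.bot σ x) : I.rank x q ≤ I.bot σ x := by
  by_cases hf : σ x = x
  · rw [bot_of_fixed hf]; exact I.rank_le _ _
  · exact h.le _ (hσ.isCand_inv hx hf)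

lemma IsSecond.eq_inv (hσ : I.IsSemistable σ) {x q : Fin n} (h : I.IsSecond σ x q)
    (hx : I.bot σ x ≤ I.rank x q) (hx' : I.top σ x < I.bot σ x) : q = σ⁻¹ x := by
  have he : I.rank x q = I.bot σ x := le_antisymm (h.rank_le_bot hσ hx') hx
  by_cases hf : σ x = x
  · rw [bot_of_fixed hf] at he
    have : q = x := h.cand.resolve_left fun hc => by have := hc.2.1; omega
    rw [this, Equiv.Perm.eq_inv_iff_eq, hf]
  · have := hσ.bot_le_of_ne hf
    exact I.eq_of_rank_eq (by omega) he

/-- If `q` preferred `u` to its successor, semistability would forbid `u` to prefer `q` to its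
predecessor. Then `q` is that predecessor, so `u` is the successor of `q` after all. -/
lemma IsSecond.top_le_rank (hσ : I.IsSemistable σ) {u q : Fin n} (h : I.IsSecond σ u q)
    (hu : I.top σ u < I.bot σ u) (hq : q ≠ u) : I.top σ q ≤ I.rank q u := by
  have hc := h.isCand hq
  by_contra! hlt
  have hqu : I.rank q u ≤ n := by have := hc.2.2; have := bot_le (I := I) (σ := σ) q; omega
  have := hσ.blocked q u (I.edge_iff.2 ⟨hqu, hc.2.1⟩) hlt
  have h1 := h.eq_inv hσ this hu
  have h2 : σ q = u := by rw [h1]; simp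
  have h3 : σ q ≠ q := by rw [h2]; exact hq.symm
  rw [top_of_ne h3, h2] at hlt
  exact lt_irrefl _ hlt

/-- A vertex whose second is its predecessor is the second of nobody but its successor. -/
lemma IsSecond.eq_apply (hσ : I.IsSemistable σ) {u q : Fin n} (hs : ∀ x, I.IsSecond σ x (s x))
    (hu : I.top σ u < I.bot σ u) (hq : s u = q) (hsq : s q = σ⁻¹ q) : u = σ q := by
  by_cases hqu : q = u
  · subst hqu
    rw [hq] at hsq
    rw [← Equiv.Perm.inv_eq_iff_eq, ← hsq]
  have h := hs u
  rw [hq] at h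
  have hc := h.isCand hqu
  have hqu' : I.rank q u ≤ n := by have := hc.2.2; have := bot_le (I := I) (σ := σ) q; omega
  -- If `u` comes strictly after the successor of `q` and prefers `q` to its predecessor, then `u`
  -- is a candidate of `q` that beats the predecessor, contrary to `hsq`. So `q` is the predecessor
  -- of `u`.
  rcases (h.top_le_rank hσ hu hqu).lt_or_eq with hlt | heq
  · have hn : ¬ I.rank u q < I.bot σ u := by
      intro hlt'
      have := (hs q).le u ⟨hlt, hqu', hlt'⟩
      rw [hsq] at this
      have h2 := hc.2.2
      unfold bot at h2
      omega
    have := h.eq_inv hσ (not_lt.1 hn) hu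
    rw [this]; simp
  · have hne : σ q ≠ q := by
      intro hf
      rw [top, if_pos hf] at heq
      have := I.rank_pos q u
      omega
    rw [top_of_ne hne] at heq
    exact (I.eq_of_rank_eq (by omega) heq).symm

lemma IsSecond.fixed (hσ : I.IsSemistable σ) {x : Fin n} (h : I.IsSecond σ x x)
    (hx : I.top σ x < I.bot σ x) : σ x = x := by
  by_contra hf
  have h1 := h.le _ (hσ.isCand_inv hx hf)
  rw [rank_self] at h1
  have h2 := hσ.bot_le_of_ne hf
  unfold bot at h2
  omega

/-- The whole orbit of `p` moves backwards. -/
def IsSettled (σ : Equiv.Perm (Fin n)) (s : Fin n → Fin n) (p : Fin n) : Prop :=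
  ∀ k : ℕ, s ((σ ^ k) p) = σ⁻¹ ((σ ^ k) p)

lemma IsSettled.apply {p : Fin n} (h : IsSettled σ s p) : IsSettled σ s (σ p) := fun k => by
  have := h (k + 1)
  rwa [pow_succ, Equiv.Perm.mul_apply] at this

/-- If the walk enters a settled orbit, then `s u` lies on it, and by `eq_apply` the only vertex
with that second is its successor. So `u` was already on the orbit: unsettled walks stay unsettled.
-/
lemma IsSettled.of_step (hσ : I.IsSemistable σ) (hs : ∀ x, I.IsSecond σ x (s x)) {u : Fin n}
    (hu : I.top σ u < I.bot σ u) (h : IsSettled σ s (σ⁻¹ (s u))) : IsSettled σ s u := by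
  have h1 := h.apply
  rw [perm_apply_inv_self] at h1
  rw [IsSecond.eq_apply hσ hs hu rfl (h1 0)]
  exact h1.apply

lemma IsSettled.of_fixed (hσ : I.IsSemistable σ) (hs : ∀ x, I.IsSecond σ x (s x)) {x : Fin n}
    (hx : I.top σ x < I.bot σ x) (h : s x = x) : IsSettled σ s x := by
  have h1 := hs x
  rw [h] at h1
  have h2 := h1.fixed hσ hx
  intro k
  have h3 : (σ ^ k) x = x := by
    induction k with
    | zero => rfl
    | succ k ih => rw [pow_succ, Equiv.Perm.mul_apply, h2, ih]
  rw [h3, h, Equiv.Perm.eq_inv_iff_eq, h2]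

/-- The vertex `s u` prefers `u` to its predecessor and likes its successor at least as much as `u`,
so it is active; activity passes back along `σ`. -/
lemma IsSecond.step_active (hσ : I.IsSemistable σ) (hs : ∀ x, I.IsSecond σ x (s x)) {u : Fin n}
    (hu : I.top σ u < I.bot σ u) : I.top σ (σ⁻¹ (s u)) < I.bot σ (σ⁻¹ (s u)) := by
  apply hσ.top_lt_bot_of_apply
  rw [perm_apply_inv_self]
  by_cases h : s u = u
  · rwa [h]
  · exact ((hs u).top_le_rank hσ hu h).trans_lt ((hs u).isCand h).2.2

end

/-! ### Rotations and their elimination. -/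

/-- The set on which a rotation acts: the map `x ↦ σ⁻¹ (s x)` permutes it, it consists of vertices
that are not paired, and it contains no settled vertex. -/
structure IsRotation (I : Roommates n) (σ : Equiv.Perm (Fin n)) (s : Fin n → Fin n)
    (Z : Set (Fin n)) : Prop where
  active : ∀ x ∈ Z, I.top σ x < I.bot σ x
  unsettled : ∀ x ∈ Z, ¬ IsSettled σ s x
  maps : ∀ x ∈ Z, σ⁻¹ (s x) ∈ Z
  inj : ∀ x ∈ Z, ∀ y ∈ Z, s x = s y → x = y
  surj : ∀ y ∈ Z, ∃ x ∈ Z, s x = σ y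

open Classical in
-- On `Z` the map `s` is injective with values in `σ '' Z`, so it cannot collide with `σ` outside
-- `Z`.
lemma IsRotation.exists_perm {I : Roommates n} {σ : Equiv.Perm (Fin n)} {s : Fin n → Fin n}
    {Z : Set (Fin n)} (hZ : I.IsRotation σ s Z) :
    ∃ σ' : Equiv.Perm (Fin n), ∀ x, σ' x = if x ∈ Z then s x else σ x := by
  have hinj : Function.Injective fun x => if x ∈ Z then s x else σ x := by
    intro x y hxy
    simp only at hxy
    have key : ∀ x ∈ Z, ∀ y ∉ Z, s x ≠ σ y := by
      intro x hx y hy h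
      apply hy
      have := hZ.maps x hx
      rwa [h, perm_inv_apply_self] at this
    split_ifs at hxy with h1 h2 h2
    · exact hZ.inj x h1 y h2 hxy
    · exact absurd hxy (key x h1 y h2)
    · exact absurd hxy.symm (key y h2 x h1)
    · exact σ.injective hxy
  exact ⟨Equiv.ofBijective _ (Finite.injective_iff_bijective.1 hinj), fun x => rfl⟩

section

variable {I : Roommates n} {σ σ' : Equiv.Perm (Fin n)} {s : Fin n → Fin n} {Z : Set (Fin n)}

lemma IsRotation.second_ne (hσ : I.IsSemistable σ) (hs : ∀ x, I.IsSecond σ x (s x))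
    (hZ : I.IsRotation σ s Z) {x : Fin n} (hx : x ∈ Z) : s x ≠ x := fun h =>
  hZ.unsettled x hx (IsSettled.of_fixed hσ hs (hZ.active x hx) h)

/-- Eliminating a rotation does not move the successor of a vertex past its predecessor. -/
lemma IsRotation.rank_le (hσ : I.IsSemistable σ) (hs : ∀ x, I.IsSecond σ x (s x))
    (hZ : I.IsRotation σ s Z) {p : Fin n} (hp : p ∈ Z) (hi : s p ∈ Z) :
    I.rank (s p) (s (s p)) ≤ I.rank (s p) p := by
  obtain ⟨i, hi'⟩ : ∃ i, i = s p := ⟨_, rfl⟩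
  rw [← hi'] at hi ⊢
  by_contra! hlt
  have hpi : i ≠ p := by rw [hi']; exact hZ.second_ne hσ hs hp
  have hsec := hs p
  rw [← hi'] at hsec
  have hc := hsec.isCand hpi
  have hip : I.rank i p ≤ n := by have := hc.2.2; have := bot_le (I := I) (σ := σ) i; omega
  -- Were `i` not the predecessor of `p`, then `p` would be a candidate of `i`, and the second of
  -- `i` could not come after `p`.
  have hbad : p = σ i ∧ i = σ⁻¹ p := by
    rcases (hsec.top_le_rank hσ (hZ.active p hp) hpi).lt_or_eq with h | h
    · have hn : ¬ I.rank p i < I.bot σ p := by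
        intro h'
        have := (hs i).le p ⟨h, hip, h'⟩
        omega
      have := hsec.eq_inv hσ (not_lt.1 hn) (hZ.active p hp)
      exact ⟨by rw [this]; simp, this⟩
    · have hne : σ i ≠ i := by
        intro hf
        rw [top, if_pos hf] at h
        have := I.rank_pos i p
        omega
      rw [top_of_ne hne] at h
      have := I.eq_of_rank_eq (by omega) h
      exact ⟨this.symm, by rw [← this]; simp⟩
  -- Backward motion spreads along the orbit: `σ⁻¹` of a vertex lies in `Z`, so that vertex is the
  -- second of some element of `Z`, which `eq_apply` identifies as its successor. This makes `p`
  -- settled.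
  have key : ∀ k : ℕ, (σ ^ k) p ∈ Z ∧ σ⁻¹ ((σ ^ k) p) ∈ Z ∧
      s ((σ ^ k) p) = σ⁻¹ ((σ ^ k) p) := by
    intro k
    induction k with
    | zero =>
      refine ⟨hp, ?_, ?_⟩
      · simpa [← hbad.2] using hi
      · simpa [← hbad.2] using hi'.symm
    | succ k ih =>
      obtain ⟨h1, h2, h3⟩ := ih
      obtain ⟨u, hu, hsu⟩ := hZ.surj _ h2
      rw [perm_apply_inv_self] at hsu
      have := IsSecond.eq_apply hσ hs (hZ.active u hu) hsu h3
      rw [pow_succ', Equiv.Perm.mul_apply, ← this]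
      refine ⟨hu, ?_, ?_⟩
      · rw [this]; simpa using h1
      · rw [hsu, this]; simp
  exact hZ.unsettled p hp fun k => (key k).2.2

end

section

variable {I : Roommates n} {σ σ' : Equiv.Perm (Fin n)} {s : Fin n → Fin n} {Z : Set (Fin n)}

lemma IsRotation.top_eq (hσ : I.IsSemistable σ) (hs : ∀ x, I.IsSecond σ x (s x))
    (hZ : I.IsRotation σ s Z) (hσ' : ∀ x ∈ Z, σ' x = s x) {x : Fin n} (hx : x ∈ Z) :
    I.top σ' x = I.rank x (s x) := by
  have := hZ.second_ne hσ hs hx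
  rw [top, hσ' x hx, if_neg this]

lemma IsRotation.bot_eq (hσ' : ∀ x ∈ Z, σ' x = s x) {x : Fin n} (hx : x ∈ Z) :
    I.bot σ' (s x) = I.rank (s x) x := by
  rw [bot, ← hσ' x hx, perm_inv_apply_self]

/-- Either the new predecessor belongs to the rotation, or the predecessor is unchanged. -/
lemma IsRotation.bot_eq_or (hσ' : ∀ x ∈ Z, σ' x = s x) (hσ'' : ∀ x ∉ Z, σ' x = σ x) (q : Fin n) :
    (∃ y ∈ Z, q = s y) ∨ (σ⁻¹ q ∉ Z ∧ I.bot σ' q = I.bot σ q) := by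
  by_cases h : σ'⁻¹ q ∈ Z
  · exact Or.inl ⟨_, h, by rw [← hσ' _ h]; simp⟩
  · have h1 := hσ'' _ h
    rw [perm_apply_inv_self, ← Equiv.Perm.inv_eq_iff_eq] at h1
    rw [bot, bot, h1]
    exact Or.inr ⟨h, rfl⟩

lemma IsRotation.top_le_top (hσ : I.IsSemistable σ) (hs : ∀ x, I.IsSecond σ x (s x))
    (hZ : I.IsRotation σ s Z) (hσ' : ∀ x ∈ Z, σ' x = s x) (hσ'' : ∀ x ∉ Z, σ' x = σ x)
    (x : Fin n) : I.top σ x ≤ I.top σ' x ∧ (x ∈ Z → I.top σ x < I.top σ' x) := by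
  by_cases hx : x ∈ Z
  · have := ((hs x).isCand (hZ.second_ne hσ hs hx)).1
    rw [← hZ.top_eq hσ hs hσ' hx] at this
    exact ⟨this.le, fun _ => this⟩
  · simp [top, hσ'' x hx, hx]

lemma IsRotation.bot_le_bot (hσ : I.IsSemistable σ) (hs : ∀ x, I.IsSecond σ x (s x))
    (hZ : I.IsRotation σ s Z) (hσ' : ∀ x ∈ Z, σ' x = s x) (hσ'' : ∀ x ∉ Z, σ' x = σ x)
    (q : Fin n) : I.bot σ' q ≤ I.bot σ q := by
  rcases IsRotation.bot_eq_or (I := I) hσ' hσ'' q with ⟨y, hy, rfl⟩ | ⟨-, h⟩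
  · rw [IsRotation.bot_eq hσ' hy]
    exact ((hs y).isCand (hZ.second_ne hσ hs hy)).2.2.le
  · exact h.le

/-- Successors get worse and predecessors get better, so old instances of `blocked` persist. A new
instance concerns an agent between the old and the new successor; it precedes the best candidate,
hence is no candidate and does not want `i`. For `top_le`, the delicate vertices are those whose
successor and predecessor both change; these are handled by `rank_le`. -/
lemma IsRotation.isSemistable (hσ : I.IsSemistable σ) (hs : ∀ x, I.IsSecond σ x (s x))
    (hZ : I.IsRotation σ s Z) (hσ' : ∀ x ∈ Z, σ' x = s x) (hσ'' : ∀ x ∉ Z, σ' x = σ x) :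
    I.IsSemistable σ' where
  edge i hi := by
    by_cases h : i ∈ Z
    · rw [hσ' i h]
      have hc := (hs i).isCand (hZ.second_ne hσ hs h)
      have := bot_le (I := I) (σ := σ) (s i)
      exact I.edge_iff.2 ⟨hc.2.1, by have := hc.2.2; omega⟩
    · rw [hσ'' i h] at hi ⊢
      exact hσ.edge i hi
  top_le i := by
    rcases IsRotation.bot_eq_or (I := I) hσ' hσ'' i with ⟨y, hy, rfl⟩ | ⟨-, h⟩
    · rw [IsRotation.bot_eq hσ' hy]
      by_cases hi : s y ∈ Z
      · rw [hZ.top_eq hσ hs hσ' hi]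
        exact hZ.rank_le hσ hs hy hi
      · have : I.top σ' (s y) = I.top σ (s y) := by rw [top, top, hσ'' _ hi]
        rw [this]
        exact (hs y).top_le_rank hσ (hZ.active y hy) (hZ.second_ne hσ hs hy)
    · rw [h]
      by_cases hi : i ∈ Z
      · rw [hZ.top_eq hσ hs hσ' hi]
        exact (hs i).rank_le_bot hσ (hZ.active i hi)
      · have : I.top σ' i = I.top σ i := by rw [top, top, hσ'' _ hi]
        rw [this]
        exact hσ.top_le i
  blocked i j he hlt := by
    have hb := hZ.bot_le_bot hσ hs hσ' hσ'' j
    by_cases hi : i ∈ Z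
    · rw [hZ.top_eq hσ hs hσ' hi] at hlt
      rcases lt_trichotomy (I.rank i j) (I.top σ i) with h | h | h
      · exact hb.trans (hσ.blocked i j he h)
      · have hne : σ i ≠ i := by
          intro hf
          rw [top, if_pos hf] at h
          have := I.rank_pos i j
          omega
        rw [top_of_ne hne] at h
        have hj : j = σ i := I.eq_of_rank_eq (I.edge_iff.1 he).1 h
        have : I.rank j i = I.bot σ j := by rw [bot, hj]; simp
        rw [this]; exact hb
      · by_contra! hlt'
        have := (hs i).le j ⟨h, (I.edge_iff.1 he).1, hlt'.trans_le hb⟩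
        omega
    · have : I.top σ' i = I.top σ i := by rw [top, top, hσ'' _ hi]
      rw [this] at hlt
      exact hb.trans (hσ.blocked i j he hlt)

/-- An edge from `i` to an agent before the successor is harmless by `blocked`. After the successor,
an agent who wants `i` is a candidate, so by `h` it cannot come before the predecessor of `i`. -/
lemma IsSemistable.isStablePartition (hσ : I.IsSemistable σ) (hs : ∀ x, I.IsSecond σ x (s x))
    (h : ∀ x, I.bot σ x ≤ I.rank x (s x)) : I.IsStablePartition σ where
  edge := hσ.edge
  prefers i hi := by
    rw [prefers_iff]
    have h0 : σ i ≠ i := by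
      intro hf
      apply hi
      rw [hf, Equiv.Perm.eq_inv_iff_eq, hf]
    have h1 := hσ.top_le i
    rw [top_of_ne h0] at h1
    refine lt_of_le_of_ne h1 fun h2 => hi ?_
    exact I.eq_of_rank_eq (I.edge_iff.1 (hσ.edge i h0)).1 h2
  stable i j he hij := by
    have hlt : I.rank i j < I.bot σ i := by
      rcases hij with hf | hp
      · rw [bot_of_fixed hf]
        have := (I.edge_iff.1 he).1
        omega
      · exact I.prefers_iff.1 hp
    by_cases heq : σ⁻¹ j = i
    · exact Or.inl heq
    refine Or.inr ?_
    rw [prefers_iff]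
    have hle : I.bot σ j ≤ I.rank j i := by
      by_contra! hlt'
      rcases lt_trichotomy (I.rank i j) (I.top σ i) with h1 | h1 | h1
      · exact absurd (hσ.blocked i j he h1) (by omega)
      · have hne : σ i ≠ i := by
          intro hf
          rw [top, if_pos hf] at h1
          have := I.rank_pos i j
          omega
        rw [top_of_ne hne] at h1
        have hj : j = σ i := I.eq_of_rank_eq (I.edge_iff.1 he).1 h1
        exact heq (by rw [hj]; simp)
      · have := (hs i).le j ⟨h1, (I.edge_iff.1 he).1, hlt'⟩
        have := h i
        omega
    refine lt_of_le_of_ne hle fun h2 => heq ?_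
    exact (I.eq_of_rank_eq (I.edge_iff.1 he).2 h2.symm).symm

/-- By pigeonhole on the first `n + 1` iterates, `n` steps always reach the cycle. -/
lemma exists_period (f : Fin n → Fin n) (x : Fin n) :
    ∃ d, 0 < d ∧ d ≤ n ∧ f^[d] (f^[n] x) = f^[n] x := by
  obtain ⟨i, j, hij, h⟩ : ∃ i j : Fin (n + 1), i < j ∧ f^[i] x = f^[j] x := by
    obtain ⟨i, j, hne, h⟩ := Fintype.exists_ne_map_eq_of_card_lt
      (fun i : Fin (n + 1) => f^[i] x) (by simp)
    rcases lt_or_gt_of_ne hne with h' | h'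
    · exact ⟨i, j, h', h⟩
    · exact ⟨j, i, h', h.symm⟩
  have hij' : (i : ℕ) < j := hij
  have := j.2
  refine ⟨j - i, by omega, by omega, ?_⟩
  rw [← Function.iterate_add_apply]
  have e1 : (j : ℕ) - i + n = (n - i) + j := by omega
  have e2 : n = (n - i) + i := by omega
  rw [e1, Function.iterate_add_apply, ← h, ← Function.iterate_add_apply, ← e2]

/-- Walking along `x ↦ σ⁻¹ (s x)` from a vertex that belongs to a violated pair leads to a
rotation. -/
lemma isRotation_of_lt (hσ : I.IsSemistable σ) (hs : ∀ x, I.IsSecond σ x (s x)) {x : Fin n}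
    (hx : I.rank x (s x) < I.bot σ x) (f : Fin n → Fin n) (hf : ∀ x, f x = σ⁻¹ (s x)) :
    I.IsRotation σ s {y | ∃ k < n, y = f^[k] (f^[n] x)} := by
  have hact : ∀ k, I.top σ (f^[k] x) < I.bot σ (f^[k] x) := by
    intro k
    induction k with
    | zero =>
      have hne : s x ≠ x := by
        intro h
        rw [h, rank_self] at hx
        have := bot_le (I := I) (σ := σ) x
        omega
      exact ((hs x).isCand hne).1.trans hx
    | succ k ih =>
      rw [Function.iterate_succ_apply', hf]
      exact IsSecond.step_active hσ hs ih
  -- The start is unsettled because its second is strictly better than its predecessor.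
  have huns : ∀ k, ¬ IsSettled σ s (f^[k] x) := by
    intro k
    induction k with
    | zero =>
      intro h
      have := h 0
      simp only [pow_zero, Equiv.Perm.one_apply, Function.iterate_zero, id] at this
      rw [this] at hx
      exact lt_irrefl _ hx
    | succ k ih =>
      intro h
      rw [Function.iterate_succ_apply', hf] at h
      exact ih (IsSettled.of_step hσ hs (hact k) h)
  obtain ⟨d, hd, hdn, hper⟩ := exists_period f x
  set p := f^[n] x with hp
  have hiter : ∀ m, f^[d] (f^[m] p) = f^[m] p := by
    intro m
    rw [← Function.iterate_add_apply, add_comm, Function.iterate_add_apply, hper]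
  have hmem : ∀ m, ∃ k < n, f^[m] p = f^[k] p := by
    intro m
    refine ⟨m % d, (Nat.mod_lt _ hd).trans_le hdn, ?_⟩
    have := Function.IsPeriodicPt.iterate_mod_apply (f := f) (x := p) hper m
    exact this.symm
  refine ⟨?_, ?_, ?_, ?_, ?_⟩
  · rintro _ ⟨k, -, rfl⟩
    rw [hp, ← Function.iterate_add_apply]
    exact hact _
  · rintro _ ⟨k, -, rfl⟩
    rw [hp, ← Function.iterate_add_apply]
    exact huns _
  · rintro _ ⟨k, -, rfl⟩
    rw [← hf, ← Function.iterate_succ_apply' f]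
    exact hmem _
  · rintro _ ⟨k, -, rfl⟩ _ ⟨m, -, rfl⟩ h
    have h1 : f (f^[k] p) = f (f^[m] p) := by rw [hf, hf, h]
    -- On the cycle, `f^[d - 1]` inverts `f`.
    have h2 : ∀ m, f^[d - 1] (f (f^[m] p)) = f^[m] p := by
      intro m
      rw [← Function.iterate_succ_apply, Nat.succ_eq_add_one, Nat.sub_add_cancel hd, hiter]
    rw [← h2 k, ← h2 m, h1]
  · rintro _ ⟨k, -, rfl⟩
    refine ⟨f^[k + (d - 1)] p, hmem _, ?_⟩
    have : f (f^[k + (d - 1)] p) = f^[k] p := by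
      rw [← Function.iterate_succ_apply' f, Nat.succ_eq_add_one]
      have : k + (d - 1) + 1 = d + k := by omega
      rw [this, Function.iterate_add_apply, hiter]
    rw [← this, hf]; simp

/-- The rotation is listed as `n` iterates, possibly with repetitions, since that is how the program
traverses it. -/
lemma exists_rotation_elimination (hσ : I.IsSemistable σ) (hs : ∀ x, I.IsSecond σ x (s x))
    {x : Fin n} (hx : I.rank x (s x) < I.bot σ x) (f : Fin n → Fin n)
    (hf : ∀ x, f x = σ⁻¹ (s x)) :
    ∃ σ' : Equiv.Perm (Fin n), I.IsSemistable σ' ∧ ∑ x, I.top σ x < ∑ x, I.top σ' x ∧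
      (∀ k < n, σ' (f^[k] (f^[n] x)) = s (f^[k] (f^[n] x))) ∧
      ∀ y, (∀ k < n, y ≠ f^[k] (f^[n] x)) → σ' y = σ y := by
  classical
  have hZ := isRotation_of_lt hσ hs hx f hf
  set Z := {y | ∃ k < n, y = f^[k] (f^[n] x)} with hZdef
  obtain ⟨σ', h⟩ := hZ.exists_perm
  have h1 : ∀ x ∈ Z, σ' x = s x := fun x hx => by rw [h, if_pos hx]
  have h2 : ∀ x ∉ Z, σ' x = σ x := fun x hx => by rw [h, if_neg hx]
  refine ⟨σ', hZ.isSemistable hσ hs h1 h2, ?_, fun k hk => h1 _ ⟨k, hk, rfl⟩, fun y hy => h2 _ ?_⟩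
  · refine Finset.sum_lt_sum (fun i _ => (hZ.top_le_top hσ hs h1 h2 i).1) ⟨f^[n] x, Finset.mem_univ _,
      (hZ.top_le_top hσ hs h1 h2 _).2 ⟨0, x.pos, rfl⟩⟩
  · rintro ⟨k, hk, rfl⟩
    exact hy k hk rfl

end

end Roommates

/-! ### Cutting cycles into paths and pairing up. -/

namespace Roommates

variable {n : ℕ}

open Equiv.Perm in
-- A vertexwise form, in terms of the cycle through a vertex, replaces the set of cycle factors.
lemma picksOnePerOddCycle_iff {π : Equiv.Perm (Fin n)} {D : Finset (Fin n)} :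
    PicksOnePerOddCycle π D ↔
      (∀ i ∈ D, π i ≠ i ∧ Odd (π.cycleOf i).support.card) ∧
      ∀ x, π x ≠ x → Odd (π.cycleOf x).support.card → ∃! i, i ∈ D ∧ π.SameCycle x i := by
  have hmem : ∀ x, π x ≠ x → Odd (π.cycleOf x).support.card → π.cycleOf x ∈ oddCycles π := by
    intro x hx ho
    rw [oddCycles, Finset.mem_filter, cycleOf_mem_cycleFactorsFinset_iff, mem_support]
    exact ⟨hx, ho⟩
  have hof : ∀ σ ∈ oddCycles π, ∀ x ∈ σ.support,
      σ = π.cycleOf x ∧ π x ≠ x ∧ Odd (π.cycleOf x).support.card := by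
    intro σ hσ x hx
    rw [oddCycles, Finset.mem_filter] at hσ
    have h := cycle_is_cycleOf hx hσ.1
    refine ⟨h, ?_, h ▸ hσ.2⟩
    rw [h, mem_support_cycleOf_iff] at hx
    exact mem_support.1 hx.2
  have hsup : ∀ x, π x ≠ x → ∀ y, y ∈ (π.cycleOf x).support ↔ π.SameCycle x y := by
    intro x hx y
    rw [mem_support_cycleOf_iff, mem_support]
    exact and_iff_left hx
  constructor
  · rintro ⟨h1, h2⟩
    refine ⟨fun i hi => ?_, fun x hx ho => ?_⟩
    · obtain ⟨σ, hσ, hi'⟩ := h1 i hi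
      exact (hof σ hσ i hi').2
    · have := h2 _ (hmem x hx ho)
      simpa only [hsup x hx] using this
  · rintro ⟨h1, h2⟩
    refine ⟨fun i hi => ⟨_, hmem i (h1 i hi).1 (h1 i hi).2, ?_⟩, fun σ hσ => ?_⟩
    · rw [mem_support_cycleOf_iff, mem_support]
      exact ⟨SameCycle.refl _ _, (h1 i hi).1⟩
    · have hc : σ.IsCycle := (mem_cycleFactorsFinset_iff.1 (Finset.mem_filter.1 hσ).1).1
      obtain ⟨x, hx⟩ := hc.nonempty_support
      obtain ⟨rfl, hx', ho⟩ := hof σ hσ x hx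
      simpa only [hsup x hx'] using h2 x hx' ho

/-- Cut every cycle of `π` just before its vertex `b x`, and pair up the vertices along the
resulting path. Here `k x` is the position of `x` on the path. -/
def pairUp (π : Equiv.Perm (Fin n)) (b : Fin n → Fin n) (k : Fin n → ℕ) (x : Fin n) : Fin n :=
  if Odd (k x) then π⁻¹ x else if π x = b x then x else π x

/-- `b` picks a vertex of every cycle of `π`, and `k x` is the distance from `b x` to `x`. -/
structure IsCut (π : Equiv.Perm (Fin n)) (b : Fin n → Fin n) (k : Fin n → ℕ) : Prop where
  base : ∀ x, b (π x) = b x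
  pow : ∀ x, (π ^ k x) (b x) = x
  min : ∀ x, ∀ m < k x, (π ^ m) (b x) ≠ x

section

variable {I : Roommates n} {π : Equiv.Perm (Fin n)} {b : Fin n → Fin n} {k : Fin n → ℕ}

lemma IsCut.succ (h : IsCut π b k) {x : Fin n} (hx : π x ≠ b x) : k (π x) = k x + 1 := by
  have h1 : (π ^ (k x + 1)) (b x) = π x := by
    rw [pow_succ', Equiv.Perm.mul_apply, h.pow]
  have hle : k (π x) ≤ k x + 1 := by
    by_contra! hlt
    have := h.min (π x) _ hlt
    rw [h.base] at this
    exact this h1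
  have hp := h.pow (π x)
  rw [h.base] at hp
  rcases hk : k (π x) with _ | m
  · rw [hk] at hp
    exact absurd hp.symm hx
  · rw [hk, pow_succ', Equiv.Perm.mul_apply] at hp
    have hp := π.injective hp
    have : k x ≤ m := by
      by_contra! hlt
      exact h.min x m hlt hp
    omega

lemma IsCut.base_eq (h : IsCut π b k) {x y : Fin n} (hxy : π.SameCycle x y) : b x = b y := by
  obtain ⟨m, hm⟩ := hxy.exists_nat_pow_eq
  subst hm
  induction m with
  | zero => rfl
  | succ m ih =>
    rw [pow_succ', Equiv.Perm.mul_apply, h.base]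
    exact ih ⟨m, by simp⟩

lemma IsCut.sameCycle (h : IsCut π b k) (x : Fin n) : π.SameCycle (b x) x :=
  ⟨k x, by rw [zpow_natCast, h.pow]⟩

lemma IsCut.zero (h : IsCut π b k) {x : Fin n} (hx : x = b x) : k x = 0 := by
  by_contra hk
  exact h.min x 0 (Nat.pos_of_ne_zero hk) hx.symm

/-- A vertex at an odd position is not a base, so its predecessor is at an even position and not
last; conversely the successor of an even, non-last vertex is at an odd position. -/
lemma IsCut.pairUp_invol (h : IsCut π b k) (x : Fin n) :
    pairUp π b k (pairUp π b k x) = x := by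
  by_cases ho : Odd (k x)
  · have h1 : pairUp π b k x = π⁻¹ x := if_pos ho
    have hx : π (π⁻¹ x) ≠ b (π⁻¹ x) := by
      rw [← h.base, perm_apply_inv_self]
      intro hx
      rw [h.zero hx] at ho
      simp at ho
    have h2 := h.succ hx
    rw [perm_apply_inv_self] at h2
    have h3 : ¬ Odd (k (π⁻¹ x)) := by
      intro h3
      rw [h2] at ho
      exact (Nat.not_odd_iff_even.2 h3.add_one) ho
    rw [h1, pairUp, if_neg h3, if_neg hx, perm_apply_inv_self]
  · by_cases hx : π x = b x
    · have h1 : pairUp π b k x = x := by rw [pairUp, if_neg ho, if_pos hx]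
      rw [h1, h1]
    · have h1 : pairUp π b k x = π x := by rw [pairUp, if_neg ho, if_neg hx]
      have h2 : Odd (k (π x)) := by
        rw [h.succ hx]
        exact (Nat.not_odd_iff_even.1 ho).add_one
      rw [h1, pairUp, if_pos h2, perm_inv_apply_self]

lemma IsStablePartition.edge_inv (hπ : I.IsStablePartition π) {x : Fin n} (hx : π⁻¹ x ≠ x) :
    I.Edge x (π⁻¹ x) := by
  have := hπ.edge (π⁻¹ x)
  rw [perm_apply_inv_self] at this
  exact (this hx.symm).symm

/-- The matching that consists of the pairs given by `pairUp`. -/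
def IsCut.matching (h : IsCut π b k) (hπ : I.IsStablePartition π) : I.Matching where
  partner := pairUp π b k
  invol := h.pairUp_invol
  edge x hx := by
    unfold pairUp at hx ⊢
    split_ifs at hx ⊢ with h1 h2
    · exact hπ.edge_inv hx
    · exact absurd rfl hx
    · exact hπ.edge x hx

/-- Here `x` is last on its path, so its position is the cycle length minus one. A shorter period
would give `x` a smaller position. -/
lemma IsCut.card_support_cycleOf (h : IsCut π b k) {x : Fin n} (hx : π x ≠ x) (hb : π x = b x) :
    (π.cycleOf x).support.card = k x + 1 := by
  have hcyc := π.isCycle_cycleOf hx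
  have hpow : ∀ m : ℕ, ((π.cycleOf x) ^ m) x = (π ^ m) x := π.cycleOf_pow_apply_self x
  rw [← hcyc.orderOf]
  apply le_antisymm
  · apply Nat.le_of_dvd (Nat.succ_pos _)
    rw [orderOf_dvd_iff_pow_eq_one, hcyc.pow_eq_one_iff' (x := x) (by simpa using hx), hpow,
      pow_succ, Equiv.Perm.mul_apply, hb, h.pow]
  · by_contra! hlt
    set L := orderOf (π.cycleOf x)
    have hL : 0 < L := orderOf_pos _
    have h1 : (π ^ L) x = x := by rw [← hpow, pow_orderOf_eq_one]; rfl
    have h2 : (π ^ (k x - L)) (b x) = x := by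
      apply (π ^ L).injective
      rw [h1, ← Equiv.Perm.mul_apply, ← pow_add, Nat.add_sub_cancel' (by omega), h.pow]
    exact h.min x _ (by omega) h2

/-- `pairUp` leaves a vertex alone only if it is last and at an even position, that is, if it is
fixed or its cycle is odd; the element of `D` is then that last vertex. -/
lemma IsCut.isObtainedFrom (h : IsCut π b k) (hπ : I.IsStablePartition π) {D : Finset (Fin n)}
    (hD : PicksOnePerOddCycle π D) (hb : ∀ d ∈ D, π d = b d) :
    I.IsObtainedFrom π D (h.matching hπ) where
  along x hx := by
    change pairUp π b k x ≠ x at hx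
    change pairUp π b k x = π x ∨ pairUp π b k x = π⁻¹ x
    unfold pairUp at hx ⊢
    split_ifs at hx ⊢ with h1 h2
    · exact Or.inr rfl
    · exact absurd rfl hx
    · exact Or.inl rfl
  deleted d hd := by
    have h1 := (picksOnePerOddCycle_iff.1 hD).1 d hd
    rw [h.card_support_cycleOf h1.1 (hb d hd)] at h1
    have h2 : ¬ Odd (k d) := fun h2 => Nat.not_odd_iff_even.2 h2.add_one h1.2
    change pairUp π b k d = d
    rw [pairUp, if_neg h2, if_pos (hb d hd)]
  perfect x hxD hx := by
    change pairUp π b k x ≠ x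
    unfold pairUp
    split_ifs with h1 h2
    · intro h3
      rw [Equiv.Perm.inv_eq_iff_eq] at h3
      exact hx h3.symm
    · exfalso
      have h3 := h.card_support_cycleOf hx h2
      have h4 : Odd (π.cycleOf x).support.card := by
        rw [h3]; exact (Nat.not_odd_iff_even.1 h1).add_one
      obtain ⟨d, ⟨hd, hxd⟩, -⟩ := (picksOnePerOddCycle_iff.1 hD).2 x hx h4
      have : π d = π x := by rw [hb d hd, h2, h.base_eq hxd]
      exact hxD (π.injective this ▸ hd)
    · exact hx

/-- The last vertices of the odd cycles. -/
lemma IsCut.exists_picks (h : IsCut π b k) :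
    ∃ D : Finset (Fin n), PicksOnePerOddCycle π D ∧ ∀ d ∈ D, π d = b d := by
  refine ⟨Finset.univ.filter fun x => π x ≠ x ∧ Odd (π.cycleOf x).support.card ∧ π x = b x, ?_, ?_⟩
  · rw [picksOnePerOddCycle_iff]
    refine ⟨fun i hi => ?_, fun x hx ho => ?_⟩
    · rw [Finset.mem_filter] at hi
      exact ⟨hi.2.1, hi.2.2.1⟩
    · have hs : π.SameCycle x (π⁻¹ (b x)) := by
        rw [← Equiv.Perm.sameCycle_apply_right, perm_apply_inv_self]
        exact (h.sameCycle x).symm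
      refine ⟨π⁻¹ (b x), ⟨?_, hs⟩, ?_⟩
      · rw [Finset.mem_filter, ← hs.cycleOf_eq, ← h.base_eq hs, perm_apply_inv_self]
        refine ⟨Finset.mem_univ _, ?_, ho, rfl⟩
        -- If the last vertex were fixed, the base would be fixed, and so would `x`.
        intro h1
        have h2 : π (b x) = b x := by
          conv_lhs => rw [h1]
          simp
        have h3 := h.sameCycle x
        obtain ⟨m, hm⟩ := h3.exists_nat_pow_eq
        have : (π ^ m) (b x) = b x := by
          clear hm
          induction m with
          | zero => rfl
          | succ m ih => rw [pow_succ, Equiv.Perm.mul_apply, h2, ih]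
        rw [this] at hm
        rw [hm] at h2
        exact hx h2
      · rintro y ⟨hy, hxy⟩
        rw [Finset.mem_filter] at hy
        rw [Equiv.Perm.eq_inv_iff_eq, hy.2.2.2, h.base_eq hxy]
  · intro d hd
    exact (Finset.mem_filter.1 hd).2.2.2

end

lemma exists_isCut (π : Equiv.Perm (Fin n)) (c : Quotient (Equiv.Perm.SameCycle.setoid π) → Fin n)
    (hc : ∀ q, Quotient.mk _ (c q) = q) :
    ∃ k, IsCut π (fun x => c (Quotient.mk _ x)) k := by
  classical
  have hs : ∀ x, π.SameCycle (c (Quotient.mk _ x)) x := fun x => Quotient.exact (hc _)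
  have he : ∀ x, ∃ m : ℕ, (π ^ m) (c (Quotient.mk _ x)) = x := fun x => (hs x).exists_nat_pow_eq
  refine ⟨fun x => Nat.find (he x), fun x => ?_, fun x => Nat.find_spec (he x),
    fun x m hm => Nat.find_min (he x) hm⟩
  congr 1
  exact Quotient.sound (Equiv.Perm.sameCycle_apply_left.2 (Equiv.Perm.SameCycle.refl π x))

lemma exists_picksOnePerOddCycle (π : Equiv.Perm (Fin n)) :
    ∃ D : Finset (Fin n), PicksOnePerOddCycle π D := by
  obtain ⟨k, hk⟩ := exists_isCut π Quotient.out fun q => Quotient.out_eq q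
  obtain ⟨D, hD, -⟩ := hk.exists_picks
  exact ⟨D, hD⟩

/-- Each odd cycle is cut just after its vertex `d` of `D`, that is, with base `π d`; other cycles
are cut anywhere. -/
lemma exists_isObtainedFrom {I : Roommates n} {π : Equiv.Perm (Fin n)}
    (hπ : I.IsStablePartition π) {D : Finset (Fin n)} (hD : PicksOnePerOddCycle π D) :
    ∃ M : I.Matching, I.IsObtainedFrom π D M := by
  classical
  let S := Equiv.Perm.SameCycle.setoid π
  have hc : ∀ q : Quotient S, ∃ y : Fin n, Quotient.mk S y = q ∧
      ∀ d ∈ D, Quotient.mk S d = q → π d = y := by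
    intro q
    by_cases h : ∃ d ∈ D, Quotient.mk S d = q
    · obtain ⟨d, hd, hdq⟩ := h
      refine ⟨π d, ?_, ?_⟩
      · rw [← hdq]
        exact Quotient.sound (Equiv.Perm.sameCycle_apply_left.2 (Equiv.Perm.SameCycle.refl π d))
      · intro d' hd' hd'q
        obtain ⟨h1, h2⟩ := picksOnePerOddCycle_iff.1 hD
        obtain ⟨y, -, hy⟩ := h2 d (h1 d hd).1 (h1 d hd).2
        rw [hy d ⟨hd, Equiv.Perm.SameCycle.refl π d⟩,
          hy d' ⟨hd', Quotient.exact (hdq.trans hd'q.symm)⟩]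
    · push Not at h
      exact ⟨q.out, q.out_eq, fun d hd hdq => absurd hdq (h d hd)⟩
  choose c hc1 hc2 using hc
  obtain ⟨k, hk⟩ := exists_isCut π c hc1
  exact ⟨_, hk.isObtainedFrom hπ hD fun d hd => hc2 _ d hd rfl⟩

/-! ### The bound on the number of improving agents. -/

lemma card_le_card_oddCycles {π : Equiv.Perm (Fin n)} {D : Finset (Fin n)}
    (hD : PicksOnePerOddCycle π D) : D.card ≤ (oddCycles π).card := by
  have h := picksOnePerOddCycle_iff.1 hD
  refine Finset.card_le_card_of_injOn (fun d => π.cycleOf d) (fun d hd => ?_) ?_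
  · rw [Finset.mem_coe, oddCycles, Finset.mem_filter,
      Equiv.Perm.cycleOf_mem_cycleFactorsFinset_iff, Equiv.Perm.mem_support]
    exact h.1 d hd
  · intro d hd d' hd' heq
    obtain ⟨y, -, hy⟩ := h.2 d (h.1 d hd).1 (h.1 d hd).2
    have hmem : d' ∈ (π.cycleOf d).support := by
      simp only at heq
      rw [heq, Equiv.Perm.mem_support_cycleOf_iff, Equiv.Perm.mem_support]
      exact ⟨Equiv.Perm.SameCycle.refl π d', (h.1 d' hd').1⟩
    rw [hy d ⟨hd, Equiv.Perm.SameCycle.refl π d⟩,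
      hy d' ⟨hd', (Equiv.Perm.mem_support_cycleOf_iff.1 hmem).1⟩]

lemma three_mul_card_oddCycles_le (π : Equiv.Perm (Fin n)) : 3 * (oddCycles π).card ≤ n := by
  have h1 : ∑ σ ∈ π.cycleFactorsFinset, σ.support.card = π.support.card := by
    rw [← π.sum_cycleType, Equiv.Perm.cycleType_def]; rfl
  have h2 : ∑ σ ∈ oddCycles π, 3 ≤ ∑ σ ∈ oddCycles π, σ.support.card := by
    refine Finset.sum_le_sum fun σ hσ => ?_
    rw [oddCycles, Finset.mem_filter] at hσ
    have h3 := (Equiv.Perm.mem_cycleFactorsFinset_iff.1 hσ.1).1.two_le_card_support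
    obtain ⟨m, hm⟩ := hσ.2
    omega
  have h3 : ∑ σ ∈ oddCycles π, σ.support.card ≤ ∑ σ ∈ π.cycleFactorsFinset, σ.support.card :=
    Finset.sum_le_sum_of_subset (Finset.filter_subset _ _)
  have h4 : π.support.card ≤ n := by simpa using Finset.card_le_univ π.support
  rw [Finset.sum_const, smul_eq_mul] at h2
  omega

section

variable {I : Roommates n} {π : Equiv.Perm (Fin n)} {D : Finset (Fin n)} {M : I.Matching}

/-- Away from `D`, nobody is worse off in `M` than with the predecessor. -/
lemma IsObtainedFrom.rank_le (hπ : I.IsStablePartition π) (hM : I.IsObtainedFrom π D M) {i : Fin n}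
    (hi : i ∉ D) : I.rank i (M.partner i) ≤ I.rank i (π⁻¹ i) := by
  by_cases hf : π i = i
  · have : π⁻¹ i = i := by rw [Equiv.Perm.inv_eq_iff_eq, hf]
    rw [this, rank_self]
    exact I.rank_le _ _
  · rcases hM.along i (hM.perfect i hi hf) with h | h
    · rw [h]
      by_cases h' : π i = π⁻¹ i
      · rw [h']
      · exact (I.prefers_iff.1 (hπ.prefers i h')).le
    · rw [h]

/-- Every agent in `S` gets in `M'` something better than its predecessor. By stability its partner
in `M'` does not, so `S` and its image under `M'` are disjoint. -/
lemma IsObtainedFrom.card_improving_le (hπ : I.IsStablePartition π)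
    (hM : I.IsObtainedFrom π D M) (M' : I.Matching) :
    2 * (I.improving M M').card ≤ n + 2 * D.card := by
  classical
  set S := I.improving M M' \ D with hS
  have hmem : ∀ i ∈ S, I.rank i (M'.partner i) < I.rank i (π⁻¹ i) := by
    intro i hi
    rw [hS, Finset.mem_sdiff, improving, Finset.mem_filter] at hi
    exact (I.prefers_iff.1 hi.1.2).trans_le (hM.rank_le hπ hi.2)
  have hdisj : Disjoint S (S.image M'.partner) := by
    rw [Finset.disjoint_left]
    intro j hj hj'
    obtain ⟨i, hi, rfl⟩ := Finset.mem_image.1 hj'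
    have h1 := hmem i hi
    have h2 := hmem _ hj
    rw [M'.invol] at h2
    have hne : M'.partner i ≠ i := by
      intro h
      rw [h, rank_self] at h1
      have := I.rank_le i (π⁻¹ i)
      omega
    rcases hπ.stable i _ (M'.edge i hne) (Or.inr (I.prefers_iff.2 h1)) with h | h
    · rw [h] at h2; exact lt_irrefl _ h2
    · exact lt_asymm h2 (I.prefers_iff.1 h)
  have hinj : Function.Injective M'.partner := Function.LeftInverse.injective M'.invol
  have h1 : (S ∪ S.image M'.partner).card ≤ n := by
    simpa using Finset.card_le_univ (S ∪ S.image M'.partner)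
  rw [Finset.card_union_of_disjoint hdisj, Finset.card_image_of_injective _ hinj] at h1
  have h2 : (I.improving M M').card ≤ S.card + D.card := Finset.card_le_card_sdiff_add_card
  omega

lemma card_half_add_le (π : Equiv.Perm (Fin n)) :
    (n : ℝ) / 2 + ((oddCycles π).card : ℝ) ≤ 5 * (n : ℝ) / 6 := by
  have h : ((3 * (oddCycles π).card : ℕ) : ℝ) ≤ n := by
    exact_mod_cast three_mul_card_oddCycles_le π
  push_cast at h
  linarith

lemma IsObtainedFrom.card_improving_le_half (hπ : I.IsStablePartition π)
    (hD : PicksOnePerOddCycle π D) (hM : I.IsObtainedFrom π D M) (M' : I.Matching) :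
    ((I.improving M M').card : ℝ) ≤ (n : ℝ) / 2 + ((oddCycles π).card : ℝ) := by
  have h1 := hM.card_improving_le hπ M'
  have h2 := card_le_card_oddCycles hD
  have h3 : ((2 * (I.improving M M').card : ℕ) : ℝ) ≤ ((n + 2 * (oddCycles π).card : ℕ) : ℝ) := by
    exact_mod_cast (by omega)
  push_cast at h3
  linarith

lemma IsObtainedFrom.isKStable (hπ : I.IsStablePartition π)
    (hD : PicksOnePerOddCycle π D) (hM : I.IsObtainedFrom π D M) {c : ℝ} (hc : 5 / 6 < c) :
    I.IsKStable (c * n) M := by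
  rintro ⟨M', hne, hle⟩
  have h1 := hM.card_improving_le_half hπ hD M'
  have h2 := card_half_add_le π
  -- For `n = 0` the threshold is `0` and counting says nothing, but there is only one matching.
  rcases Nat.eq_zero_or_pos n with rfl | hn
  · exact hne (Matching.ext (funext fun i => i.elim0))
  · have : (0 : ℝ) < n := by exact_mod_cast hn
    nlinarith

end

end Roommates

/-! ### Counting-loop programs, their semantics and running time. -/

namespace RAM

/-- Programs whose only loops are counting loops: `forLt x C` runs `C` for `x = 0, …, n - 1`,
where `n` is the content of variable `0`. -/
inductive Code where
  | skip
  | assign (x : ℕ) (e : Expr)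
  | write (a : ℕ) (e f : Expr)
  | seq (C D : Code)
  | ite (e : Expr) (C D : Code)
  | forLt (x : ℕ) (C : Code)

namespace Code

def compile : Code → Prog
  | skip => .skip
  | assign x e => .assign x e
  | write a e f => .write a e f
  | seq C D => .seq C.compile D.compile
  | ite e C D => .ite e C.compile D.compile
  | forLt x C => .seq (.assign x (.const 0)) (.loop (.sub (.var 0) (.var x))
      (.seq C.compile (.assign x (.add (.var x) (.const 1)))))

/-- The final state. -/
def run : Code → State → State
  | skip, s => s
  | assign x e, s => s.setVar x (e.eval s)
  | write a e f, s => s.setArr a (e.eval s) (f.eval s)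
  | seq C D, s => D.run (C.run s)
  | ite e C D, s => if e.eval s ≠ 0 then C.run s else D.run s
  -- The number of iterations is fixed in advance; this agrees with the compiled loop when `WF`
  -- holds.
  | forLt x C, s => (fun u => (C.run u).setVar x (u.var x + 1))^[s.var 0] (s.setVar x 0)

/-- A bound for the running time, as a polynomial in the content of variable `0`. -/
noncomputable def time : Code → Polynomial ℕ
  | skip => 1
  | assign _ e => .C (e.cost + 1)
  | write _ e f => .C (e.cost + f.cost + 1)
  | seq C D => C.time + D.time
  | ite e C D => .C (e.cost + 1) + C.time + D.time
  -- A pass costs 4 for the test and 4 for the increment besides the body; the initialisation costs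
  -- 2 and the failing test 4.
  | forLt _ C => .X * (C.time + .C 8) + .C 6

/-- The variables that a program may change. -/
def setsVar : Code → ℕ → Bool
  | skip, _ => false
  | assign x _, y => x == y
  | write _ _ _, _ => false
  | seq C D, y => C.setsVar y || D.setsVar y
  | ite _ C D, y => C.setsVar y || D.setsVar y
  | forLt x C, y => x == y || C.setsVar y

/-- The arrays that a program may change. -/
def setsArr : Code → ℕ → Bool
  | skip, _ => false
  | assign _ _, _ => false
  | write a _ _, b => a == b
  | seq C D, b => C.setsArr b || D.setsArr b
  | ite _ C D, b => C.setsArr b || D.setsArr b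
  | forLt _ C, b => C.setsArr b

/-- Variable `0` is not changed, and no loop changes its own counter. -/
def WF : Code → Bool
  | skip => true
  | assign x _ => x != 0
  | write _ _ _ => true
  | seq C D => C.WF && D.WF
  | ite _ C D => C.WF && D.WF
  | forLt x C => C.WF && !C.setsVar x && x != 0

/-- `u` differs from `s` only where `C` may have made a change. -/
structure Frame (C : Code) (s u : State) : Prop where
  var : ∀ y, C.setsVar y = false → u.var y = s.var y
  arr : ∀ a, C.setsArr a = false → u.arr a = s.arr a

lemma Frame.trans {C : Code} {s u v : State} (h : C.Frame s u) (h' : C.Frame u v) :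
    C.Frame s v :=
  ⟨fun y hy => (h'.var y hy).trans (h.var y hy), fun a ha => (h'.arr a ha).trans (h.arr a ha)⟩

lemma setVar_var (s : State) (x v y : ℕ) :
    (s.setVar x v).var y = if y = x then v else s.var y := by
  simp [State.setVar, Function.update_apply]

lemma setVar_arr (s : State) (x v : ℕ) : (s.setVar x v).arr = s.arr := rfl

lemma setArr_var (s : State) (a k v : ℕ) : (s.setArr a k v).var = s.var := rfl

lemma setArr_arr (s : State) (a k v b j : ℕ) :
    (s.setArr a k v).arr b j = if b = a ∧ j = k then v else s.arr b j := by
  by_cases h : b = a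
  · subst h; simp [State.setArr, Function.update_apply]
  · simp [State.setArr, h]

/-- The sets of changed variables and arrays are computed from the syntax, so later side conditions
of this kind hold by `rfl`. -/
lemma frame_run (C : Code) (s : State) : C.Frame s (C.run s) := by
  induction C generalizing s with
  | skip => exact ⟨fun _ _ => rfl, fun _ _ => rfl⟩
  | assign x e =>
    refine ⟨fun y hy => ?_, fun _ _ => rfl⟩
    simp only [setsVar, beq_eq_false_iff_ne] at hy
    simp [run, setVar_var, hy.symm]
  | write a e f =>
    refine ⟨fun _ _ => rfl, fun b hb => ?_⟩
    simp only [setsArr, beq_eq_false_iff_ne] at hb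
    ext j
    simp [run, setArr_arr, hb.symm]
  | seq C D hC hD =>
    refine ⟨fun y hy => ?_, fun b hb => ?_⟩
    · simp only [setsVar, Bool.or_eq_false_iff] at hy
      exact ((hD _).var y hy.2).trans ((hC s).var y hy.1)
    · simp only [setsArr, Bool.or_eq_false_iff] at hb
      exact ((hD _).arr b hb.2).trans ((hC s).arr b hb.1)
  | ite e C D hC hD =>
    refine ⟨fun y hy => ?_, fun b hb => ?_⟩
    · simp only [setsVar, Bool.or_eq_false_iff] at hy
      unfold run
      split_ifs
      · exact (hC s).var y hy.1
      · exact (hD s).var y hy.2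
    · simp only [setsArr, Bool.or_eq_false_iff] at hb
      unfold run
      split_ifs
      · exact (hC s).arr b hb.1
      · exact (hD s).arr b hb.2
  | forLt x C hC =>
    have key : ∀ m u, (forLt x C).Frame u
        ((fun u => (C.run u).setVar x (u.var x + 1))^[m] u) := by
      intro m
      induction m with
      | zero => exact fun u => ⟨fun _ _ => rfl, fun _ _ => rfl⟩
      | succ m ih =>
        intro u
        rw [Function.iterate_succ_apply]
        refine Frame.trans (u := (C.run u).setVar x (u.var x + 1))
          ⟨fun y hy => ?_, fun b hb => (hC u).arr b hb⟩ (ih _)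
        simp only [setsVar, Bool.or_eq_false_iff, beq_eq_false_iff_ne] at hy
        rw [setVar_var, if_neg (Ne.symm hy.1)]
        exact (hC u).var y hy.2
    refine Frame.trans (u := s.setVar x 0) ⟨fun y hy => ?_, fun b hb => rfl⟩ (key _ _)
    simp only [setsVar, Bool.or_eq_false_iff, beq_eq_false_iff_ne] at hy
    rw [setVar_var, if_neg (Ne.symm hy.1)]

lemma setsVar_zero {C : Code} (h : C.WF = true) : C.setsVar 0 = false := by
  induction C with
  | skip => rfl
  | assign x e => simpa [WF, setsVar] using h
  | write a e f => rfl
  | seq C D hC hD =>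
    simp only [WF, Bool.and_eq_true] at h
    simp [setsVar, hC h.1, hD h.2]
  | ite e C D hC hD =>
    simp only [WF, Bool.and_eq_true] at h
    simp [setsVar, hC h.1, hD h.2]
  | forLt x C hC =>
    simp only [WF, Bool.and_eq_true, bne_iff_ne] at h
    simp [setsVar, hC h.1.1, h.2]

lemma wf_forLt {x : ℕ} {C : Code} (h : (forLt x C).WF = true) :
    C.WF = true ∧ C.setsVar x = false ∧ C.setsVar 0 = false ∧ x ≠ 0 := by
  have h' : C.WF = true ∧ C.setsVar x = false ∧ x ≠ 0 := by simpa [WF, and_assoc] using h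
  exact ⟨h'.1, h'.2.1, setsVar_zero h'.1, h'.2.2⟩

/-- The loop rule. -/
lemma run_forLt {x : ℕ} {C : Code} (h : (forLt x C).WF = true) (s : State)
    (Inv : ℕ → State → Prop) (h0 : Inv 0 (s.setVar x 0))
    (step : ∀ k < s.var 0, ∀ u, (forLt x C).Frame s u → u.var 0 = s.var 0 → u.var x = k →
      Inv k u → Inv (k + 1) ((C.run u).setVar x (k + 1))) :
    Inv (s.var 0) ((forLt x C).run s) := by
  obtain ⟨-, hx, h0', hx0⟩ := wf_forLt h
  have key : ∀ m ≤ s.var 0,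
      (forLt x C).Frame s ((fun u => (C.run u).setVar x (u.var x + 1))^[m] (s.setVar x 0)) ∧
      ((fun u => (C.run u).setVar x (u.var x + 1))^[m] (s.setVar x 0)).var x = m ∧
      Inv m ((fun u => (C.run u).setVar x (u.var x + 1))^[m] (s.setVar x 0)) := by
    intro m
    induction m with
    | zero =>
      intro _
      refine ⟨⟨fun y hy => ?_, fun _ _ => rfl⟩, ?_, h0⟩
      · simp only [setsVar, Bool.or_eq_false_iff, beq_eq_false_iff_ne] at hy
        simp [setVar_var, hy.1.symm]
      · simp [setVar_var]
    | succ m ih =>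
      intro hm
      obtain ⟨h1, h2, h3⟩ := ih (by omega)
      rw [Function.iterate_succ_apply']
      refine ⟨h1.trans ⟨fun y hy => ?_, fun b hb => (frame_run C _).arr b hb⟩, ?_, ?_⟩
      · simp only [setsVar, Bool.or_eq_false_iff, beq_eq_false_iff_ne] at hy
        rw [setVar_var, if_neg (Ne.symm hy.1)]
        exact (frame_run C _).var y hy.2
      · rw [setVar_var, if_pos rfl, h2]
      · rw [h2]
        exact step m (by omega) _ h1 (h1.var 0 (by simp [setsVar, h0', hx0])) h2 h3
  exact (key _ le_rfl).2.2

/-- The induction is on the number of remaining passes, which is the value of the loop test. -/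
lemma exec_loop {x : ℕ} {C : Code} (h : (forLt x C).WF = true)
    (hC : ∀ s, ∃ t, Exec C.compile s t (C.run s) ∧ t ≤ C.time.eval (s.var 0)) (m : ℕ) (u : State)
    (hu : u.var 0 - u.var x = m) :
    ∃ t, Exec (.loop (.sub (.var 0) (.var x))
        (.seq C.compile (.assign x (.add (.var x) (.const 1))))) u t
        ((fun u => (C.run u).setVar x (u.var x + 1))^[m] u) ∧
      t ≤ m * (C.time.eval (u.var 0) + 8) + 4 := by
  obtain ⟨-, hx, h0, hx0⟩ := wf_forLt h
  induction m generalizing u with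
  | zero => exact ⟨_, Exec.loop_done hu, by simp [Expr.cost]⟩
  | succ m ih =>
    obtain ⟨t, ht, htle⟩ := hC u
    have hvx := (frame_run C u).var x hx
    have hv0 := (frame_run C u).var 0 h0
    have hv0' : ((C.run u).setVar x (u.var x + 1)).var 0 = u.var 0 := by
      rw [setVar_var, if_neg hx0.symm, hv0]
    obtain ⟨t', ht', htle'⟩ := ih ((C.run u).setVar x (u.var x + 1)) (by
      rw [hv0', setVar_var, if_pos rfl]; omega)
    rw [hv0'] at htle'
    have ha := Exec.assign (C.run u) x (.add (.var x) (.const 1))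
    simp only [Expr.eval, hvx] at ha
    refine ⟨_, Exec.loop_step (t' := t') (by simp only [Expr.eval]; omega) (Exec.seq ht ha) ?_, ?_⟩
    · rw [Function.iterate_succ_apply]; exact ht'
    · simp only [Expr.cost]
      rw [add_mul, one_mul]
      omega

lemma exec_compile {C : Code} (h : C.WF = true) (s : State) :
    ∃ t, Exec C.compile s t (C.run s) ∧ t ≤ C.time.eval (s.var 0) := by
  induction C generalizing s with
  | skip => exact ⟨_, Exec.skip s, by simp [time]⟩
  | assign x e => exact ⟨_, Exec.assign s x e, by simp [time]⟩
  | write a e f => exact ⟨_, Exec.write s a e f, by simp [time]⟩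
  | seq C D hC hD =>
    simp only [WF, Bool.and_eq_true] at h
    obtain ⟨t, h1, h2⟩ := hC h.1 s
    obtain ⟨t', h3, h4⟩ := hD h.2 (C.run s)
    rw [(frame_run C s).var 0 (setsVar_zero h.1)] at h4
    exact ⟨_, Exec.seq h1 h3, by rw [time, Polynomial.eval_add]; omega⟩
  | ite e C D hC hD =>
    simp only [WF, Bool.and_eq_true] at h
    simp only [time, Polynomial.eval_add, Polynomial.eval_C]
    by_cases he : e.eval s = 0
    · obtain ⟨t, h1, h2⟩ := hD h.2 s
      rw [run, if_neg (not_not.2 he)]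
      exact ⟨_, Exec.ite_false he h1, by omega⟩
    · obtain ⟨t, h1, h2⟩ := hC h.1 s
      rw [run, if_pos he]
      exact ⟨_, Exec.ite_true he h1, by omega⟩
  | forLt x C hC =>
    obtain ⟨h1, -, -, hx0⟩ := wf_forLt h
    have hv : (s.setVar x 0).var 0 = s.var 0 := by rw [setVar_var, if_neg hx0.symm]
    obtain ⟨t, h2, h3⟩ := exec_loop h (fun s => hC h1 s) (s.var 0) (s.setVar x 0) (by
      rw [hv, setVar_var, if_pos rfl]; rfl)
    rw [hv] at h3
    refine ⟨_, Exec.seq (Exec.assign s x (.const 0)) h2, ?_⟩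
    simp only [time, Polynomial.eval_add, Polynomial.eval_mul, Polynomial.eval_X,
      Polynomial.eval_C, Expr.cost]
    omega

end Code

end RAM

/-! ### Comparisons and table lookups as expressions. -/

namespace RAM

/-- An expression that is not zero if and only if `e` and `f` differ. -/
def Expr.ne (e f : Expr) : Expr := .add (.sub e f) (.sub f e)

lemma Expr.eval_ne {e f : Expr} {s : State} : (Expr.ne e f).eval s ≠ 0 ↔ e.eval s ≠ f.eval s := by
  simp only [Expr.ne, Expr.eval]; omega

lemma Expr.eval_sub {e f : Expr} {s : State} :
    (Expr.sub e f).eval s ≠ 0 ↔ f.eval s < e.eval s := by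
  simp only [Expr.eval]; omega

/-- The rank of `f` on the list of `e`. Array `2` holds the starts of the rows of array `3`. -/
def Expr.rank (e f : Expr) : Expr := .read 3 (.add (.read 2 e) f)

end RAM

namespace Roommates

open RAM RAM.Code

variable {n : ℕ}

/-! ### The rank table -/

/-- Without multiplication, the row starts come from repeated addition in variable `2`. -/
def rowsBody : Code := .seq (.write 2 (.var 1) (.var 2)) (.assign 2 (.add (.var 2) (.var 0)))

/-- Array `2` receives the multiples of `n`. -/
def rows : Code := .forLt 1 rowsBody

/-- Variable `4` already holds the default `n + 1`. Input cells store an agent plus one, hence the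
shift. -/
def findPosBody : Code :=
  .ite (.ne (.read 0 (.add (.read 2 (.var 1)) (.var 3))) (.add (.var 2) (.const 1)))
    .skip (.assign 4 (.add (.var 3) (.const 1)))

def findPos : Code := .forLt 3 findPosBody

def rankRowBody : Code :=
  .seq (.assign 4 (.add (.var 0) (.const 1)))
    (.seq findPos (.write 3 (.add (.read 2 (.var 1)) (.var 2)) (.var 4)))

def rankRow : Code := .forLt 2 rankRowBody

/-- Array `3` receives the ranks. -/
def rankTable : Code := .forLt 1 rankRow

lemma run_rows (s : State) : ∀ k < s.var 0, (rows.run (s.setVar 2 0)).arr 2 k = k * s.var 0 := by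
  have := run_forLt (x := 1) (C := rowsBody) rfl (s.setVar 2 0)
    (fun k u => u.var 2 = k * s.var 0 ∧ ∀ j < k, u.arr 2 j = j * s.var 0)
    (by simp [setVar_var]) (by
      rintro k hk u hf h0 h1 ⟨h2, h3⟩
      have h0' : u.var 0 = s.var 0 := h0
      simp only [rowsBody, run, Expr.eval, setVar_var, setVar_arr, setArr_var, setArr_arr, h0', h1,
        h2]
      refine ⟨by simp [add_mul], fun j hj => ?_⟩
      by_cases hjk : j = k
      · simp [hjk]
      · simp only [hjk, and_false, if_false]
        exact h3 j (by omega))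
  exact this.2

lemma inputCell_eq_iff (I : Roommates n) (i j : Fin n) {r : ℕ} (hr : r < n) :
    I.inputCell (i * n + r) = j + 1 ↔ j ∈ I.pref i ∧ (I.pref i).idxOf j = r := by
  have hn : 0 < n := i.pos
  have h1 : (i * n + r) / n = i := by
    rw [mul_comm, Nat.mul_add_div hn, Nat.div_eq_of_lt hr, add_zero]
  have h2 : (i * n + r) % n = r := by
    rw [mul_comm, Nat.mul_add_mod, Nat.mod_eq_of_lt hr]
  have h3 : I.inputCell (i * n + r) =
      match (I.pref i)[r]? with
      | some j => (j : ℕ) + 1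
      | none => 0 := by
    simp only [inputCell, h1, h2, i.2, dif_pos, Fin.eta]
  rw [h3]
  constructor
  · intro h
    rcases hc : (I.pref i)[r]? with _ | j'
    · rw [hc] at h; simp at h
    · rw [hc] at h
      have : j' = j := Fin.ext (by simpa using h)
      subst this
      obtain ⟨hlt, hget⟩ := List.getElem?_eq_some_iff.1 hc
      subst hget
      exact ⟨List.getElem_mem hlt, (I.nodup i).idxOf_getElem r hlt⟩
  · rintro ⟨hm, rfl⟩
    have hlt := List.idxOf_lt_length_of_mem hm
    rw [List.getElem?_eq_getElem hlt, List.getElem_idxOf]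

lemma run_findPos (I : Roommates n) (i j : Fin n) (s : State) (h0 : s.var 0 = n)
    (h1 : s.var 1 = i) (h2 : s.var 2 = j) (h4 : s.var 4 = n + 1) (ha : s.arr 0 = I.inputCell)
    (hr : s.arr 2 i = i * n) : (findPos.run s).var 4 = I.rank i j := by
  have := run_forLt (x := 3) (C := findPosBody) rfl s
    (fun k u => u.var 4 = if j ∈ I.pref i ∧ (I.pref i).idxOf j < k then (I.pref i).idxOf j + 1
      else n + 1)
    (by simp [setVar_var, h4]) (by
      intro k hk u hf _ h3 hinv
      have e1 := (hf.var 1 rfl).trans h1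
      have e2 := (hf.var 2 rfl).trans h2
      have e3 : u.arr 0 = I.inputCell := (hf.arr 0 rfl).trans ha
      have e4 : u.arr 2 i = i * n := by rw [hf.arr 2 rfl, hr]
      have hc := I.inputCell_eq_iff i j (h0 ▸ hk)
      simp only [findPosBody, run, Expr.eval_ne, setVar_var]
      simp only [Expr.eval, h3, e1, e2, e3, e4, ne_eq, hc]
      by_cases hj : j ∈ I.pref i
      · by_cases hk' : (I.pref i).idxOf j = k
        · simp [hj, hk', setVar_var]
        · simp only [hj, hk', and_false, not_false_eq_true, if_true, true_and, hinv,
            Nat.reduceEqDiff, if_false]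
          congr 1
          simp only [eq_iff_iff]
          omega
      · simpa [hj] using hinv)
  rw [h0] at this
  have hlen := I.length_pref_le i
  refine (this : (findPos.run s).var 4 = _).trans ?_
  by_cases hj : j ∈ I.pref i
  · have := List.idxOf_lt_length_of_mem hj
    rw [if_pos ⟨hj, by omega⟩, rank, if_pos hj]
  · simp [rank, hj]

/-- Array `2` holds the starts of the rows of the rank table, which is in array `3`. -/
structure HoldsRanks (I : Roommates n) (s : State) : Prop where
  card : s.var 0 = n
  row : ∀ i : Fin n, s.arr 2 i = i * n
  rank : ∀ i j : Fin n, s.arr 3 (i * n + j) = I.rank i j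

/-- The second claim keeps the rows that the outer loop has already filled. -/
lemma run_rankRow (I : Roommates n) (i : Fin n) (s : State) (h0 : s.var 0 = n)
    (h1 : s.var 1 = i) (ha : s.arr 0 = I.inputCell) (hr : s.arr 2 i = i * n) :
    (∀ j : Fin n, (rankRow.run s).arr 3 (i * n + j) = I.rank i j) ∧
      ∀ m < i * n, (rankRow.run s).arr 3 m = s.arr 3 m := by
  have := run_forLt (x := 2) (C := rankRowBody) rfl s
    (fun k u => (∀ j : Fin n, (j : ℕ) < k → u.arr 3 (i * n + j) = I.rank i j) ∧
      ∀ m < i * n, u.arr 3 m = s.arr 3 m)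
    ⟨fun j hj => absurd hj (by omega), fun m hm => rfl⟩ (by
      rintro k hk u hf e0 h2 ⟨hinv1, hinv2⟩
      have e1 := (hf.var 1 rfl).trans h1
      have e3 : u.arr 0 = I.inputCell := (hf.arr 0 rfl).trans ha
      have e4 : u.arr 2 i = i * n := by rw [hf.arr 2 rfl, hr]
      rw [h0] at hk e0
      set v := (Code.assign 4 (.add (.var 0) (.const 1))).run u with hv
      have hvar : ∀ y, v.var y = if y = 4 then n + 1 else u.var y := by
        intro y; rw [hv]; simp [run, setVar_var, Expr.eval, e0]
      have harr : v.arr = u.arr := rfl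
      have key := run_findPos I i ⟨k, hk⟩ v (by simp [hvar, e0]) (by simp [hvar, e1])
        (by simp [hvar, h2]) (by simp [hvar]) (by rw [harr, e3]) (by rw [harr, e4])
      have hfr := frame_run findPos v
      have k1 : (findPos.run v).var 1 = i := by rw [hfr.var 1 rfl]; simp [hvar, e1]
      have k2 : (findPos.run v).var 2 = k := by rw [hfr.var 2 rfl]; simp [hvar, h2]
      have k3 : (findPos.run v).arr 3 = u.arr 3 := hfr.arr 3 rfl
      have k4 : (findPos.run v).arr 2 i = i * n := by rw [hfr.arr 2 rfl, harr, e4]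
      have hrun : rankRowBody.run u = (Code.write 3 (.add (.read 2 (.var 1)) (.var 2))
        (.var 4)).run (findPos.run v) := rfl
      have hres : ∀ m, ((rankRowBody.run u).setVar 2 (k + 1)).arr 3 m =
          if m = i * n + k then I.rank i ⟨k, hk⟩ else u.arr 3 m := by
        intro m
        rw [hrun, setVar_arr]
        simp only [run, Expr.eval, setArr_arr, k1, k2, k3, k4, key, true_and]
      refine ⟨fun j hj => ?_, fun m hm => ?_⟩
      · rw [hres]
        by_cases hjk : (j : ℕ) = k
        · subst hjk; simp
        · rw [if_neg (by omega)]
          exact hinv1 j (by omega)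
      · rw [hres, if_neg (by omega)]
        exact hinv2 m hm)
  rw [h0] at this
  exact ⟨fun j => this.1 j j.2, this.2⟩

lemma run_rankTable (I : Roommates n) (s : State) (h0 : s.var 0 = n)
    (ha : s.arr 0 = I.inputCell) (hr : ∀ i : Fin n, s.arr 2 i = i * n) :
    HoldsRanks I (rankTable.run s) := by
  have hfr := frame_run rankTable s
  refine ⟨(hfr.var 0 rfl).trans h0, fun i => by rw [hfr.arr 2 rfl, hr], ?_⟩
  have := run_forLt (x := 1) (C := rankRow) rfl s
    (fun k u => ∀ i : Fin n, (i : ℕ) < k → ∀ j : Fin n, u.arr 3 (i * n + j) = I.rank i j)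
    (fun i hi => absurd hi (by omega)) (by
      intro k hk u hf e0 h1 hinv i hi j
      rw [h0] at hk e0
      have key := run_rankRow I ⟨k, hk⟩ u e0 h1 ((hf.arr 0 rfl).trans ha)
        (by rw [hf.arr 2 rfl, hr])
      rw [setVar_arr]
      by_cases hik : (i : ℕ) = k
      · subst hik; exact key.1 j
      · rw [key.2 _ _, hinv i (by omega) j]
        have : (i + 1) * n ≤ k * n := Nat.mul_le_mul_right _ (by omega)
        rw [add_mul, one_mul] at this
        have := j.2
        simp only
        omega)
  rw [h0] at this
  exact fun i j => this i i.2 j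

/-! ### One round -/

/-- Arrays `4` and `5` hold `σ` and its inverse. -/
structure HoldsPerm (I : Roommates n) (σ : Equiv.Perm (Fin n)) (s : State) : Prop
    extends HoldsRanks I s where
  succ : ∀ i : Fin n, s.arr 4 i = σ i
  pred : ∀ i : Fin n, s.arr 5 i = (σ⁻¹ i : Fin n)

lemma HoldsRanks.congr {I : Roommates n} {s u : State} (h : HoldsRanks I s)
    (h0 : u.var 0 = s.var 0) (h2 : u.arr 2 = s.arr 2) (h3 : u.arr 3 = s.arr 3) :
    HoldsRanks I u :=
  ⟨h0.trans h.card, fun i => by rw [h2, h.row], fun i j => by rw [h3, h.rank]⟩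

lemma HoldsPerm.congr {I : Roommates n} {σ : Equiv.Perm (Fin n)} {s u : State}
    (h : HoldsPerm I σ s) (h0 : u.var 0 = s.var 0) (h2 : u.arr 2 = s.arr 2)
    (h3 : u.arr 3 = s.arr 3) (h4 : u.arr 4 = s.arr 4) (h5 : u.arr 5 = s.arr 5) :
    HoldsPerm I σ u :=
  ⟨h.toHoldsRanks.congr h0 h2 h3, fun i => by rw [h4, h.succ], fun i => by rw [h5, h.pred]⟩

lemma HoldsPerm.of_frame {I : Roommates n} {σ : Equiv.Perm (Fin n)} {s u : State} {C : Code}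
    (h : HoldsPerm I σ s) (hf : C.Frame s u) (h0 : C.setsVar 0 = false)
    (h2 : C.setsArr 2 = false) (h3 : C.setsArr 3 = false) (h4 : C.setsArr 4 = false)
    (h5 : C.setsArr 5 = false) : HoldsPerm I σ u :=
  h.congr (hf.var 0 h0) (hf.arr 2 h2) (hf.arr 3 h3) (hf.arr 4 h4) (hf.arr 5 h5)

lemma HoldsRanks.eval_rank {I : Roommates n} {s : State} (h : HoldsRanks I s) {e f : Expr}
    {i j : Fin n} (he : e.eval s = i) (hf : f.eval s = j) :
    (Expr.rank e f).eval s = I.rank i j := by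
  simp only [Expr.rank, Expr.eval, he, hf, h.row, h.rank]

def initPermBody : Code := .seq (.write 4 (.var 1) (.var 1)) (.write 5 (.var 1) (.var 1))

/-- Start with the identity. -/
def initPerm : Code := .forLt 1 initPermBody

lemma run_initPerm {I : Roommates n} {s : State} (h : HoldsRanks I s) :
    HoldsPerm I 1 (initPerm.run s) := by
  have hfr := frame_run initPerm s
  have := run_forLt (x := 1) (C := initPermBody) rfl s
    (fun k u => ∀ i < k, u.arr 4 i = i ∧ u.arr 5 i = i)
    (fun i hi => absurd hi (by omega)) (by
      intro k hk u hf e0 h1 hinv i hi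
      simp only [initPermBody, run, Expr.eval, setArr_var, setVar_arr, setArr_arr, h1]
      by_cases hik : i = k
      · simp [hik]
      · simpa [hik] using hinv i (by omega))
  rw [h.card] at this
  exact ⟨h.congr (hfr.var 0 rfl) (hfr.arr 2 rfl) (hfr.arr 3 rfl), fun i => (this i i.2).1,
    fun i => (this i i.2).2⟩

/-- Variable `3` is the best candidate so far, starting from the agent itself, whose rank is `n +
1`; variable `4` is the rank of the successor. -/
def tryCand : Code :=
  .ite (.sub (.rank (.var 1) (.var 2)) (.var 4))
    (.ite (.sub (.rank (.var 2) (.read 5 (.var 2))) (.rank (.var 2) (.var 1)))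
      (.ite (.sub (.rank (.var 1) (.var 3)) (.rank (.var 1) (.var 2)))
        (.assign 3 (.var 2)) .skip) .skip) .skip

/-- Replace variable `3` by the best candidate of the agent in variable `1`. -/
def bestCand : Code := .forLt 2 tryCand

def secondBody : Code :=
  .seq (.assign 3 (.var 1))
    (.seq (.ite (.ne (.read 4 (.var 1)) (.var 1))
        (.assign 4 (.rank (.var 1) (.read 4 (.var 1)))) (.assign 4 (.const 0)))
      (.seq bestCand
        (.seq (.write 6 (.var 1) (.var 3)) (.write 7 (.var 1) (.read 5 (.var 3))))))

/-- Array `6` receives the seconds of all agents, and array `7` their predecessors. -/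
def seconds : Code := .forLt 1 secondBody

/-- The program does not test `I.rank x j ≤ n`: beating the current best, of rank at most `n + 1`,
implies it. -/
lemma run_tryCand {I : Roommates n} {σ : Equiv.Perm (Fin n)} {s : State} (h : HoldsPerm I σ s)
    {x j q : Fin n} (h1 : s.var 1 = x) (h2 : s.var 2 = j) (h3 : s.var 3 = q)
    (h4 : s.var 4 = I.top σ x) :
    (I.IsCand σ x j ∧ (tryCand.run s).var 3 = j ∧ I.rank x j ≤ I.rank x q) ∨
      ((tryCand.run s).var 3 = q ∧ (I.IsCand σ x j → I.rank x q ≤ I.rank x j)) := by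
  have hp : (Expr.read 5 (.var 2)).eval s = (σ⁻¹ j : Fin n) := by
    simp only [Expr.eval, h2, h.pred]
  simp only [tryCand, run, Expr.eval_sub, h.eval_rank (e := .var 1) (f := .var 2) h1 h2,
    h.eval_rank (e := .var 2) (f := .var 1) h2 h1, h.eval_rank (e := .var 2) h2 hp,
    h.eval_rank (e := .var 1) (f := .var 3) h1 h3]
  simp only [Expr.eval, h4]
  have hq := I.rank_le x q
  split_ifs with c1 c2 c3
  · exact Or.inl ⟨⟨c1, by omega, c2⟩, by simp [setVar_var, h2], c3.le⟩
  · exact Or.inr ⟨h3, fun _ => not_lt.1 c3⟩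
  · exact Or.inr ⟨h3, fun hc => absurd hc.2.2 c2⟩
  · exact Or.inr ⟨h3, fun hc => absurd hc.1 c1⟩

lemma run_bestCand {I : Roommates n} {σ : Equiv.Perm (Fin n)} {s : State} (h : HoldsPerm I σ s)
    {x : Fin n} (h1 : s.var 1 = x) (h3 : s.var 3 = x) (h4 : s.var 4 = I.top σ x) :
    ∃ q : Fin n, I.IsSecond σ x q ∧ (bestCand.run s).var 3 = q := by
  have := run_forLt (x := 2) (C := tryCand) rfl s
    (fun k u => ∃ q : Fin n, (I.IsCand σ x q ∨ q = x) ∧ u.var 3 = q ∧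
      ∀ j : Fin n, (j : ℕ) < k → I.IsCand σ x j → I.rank x q ≤ I.rank x j)
    ⟨x, Or.inr rfl, by simp [setVar_var, h3], fun j hj => absurd hj (by omega)⟩ (by
      rintro k hk u hf e0 h2 ⟨q, hq, hu3, hle⟩
      rw [h.card] at hk
      have hu := h.of_frame hf rfl rfl rfl rfl rfl
      have e1 := (hf.var 1 rfl).trans h1
      have e4 := (hf.var 4 rfl).trans h4
      simp only [setVar_var]
      rcases run_tryCand hu (j := ⟨k, hk⟩) e1 h2 hu3 e4 with ⟨hc, hv, hlt⟩ | ⟨hv, hc⟩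
      · refine ⟨⟨k, hk⟩, Or.inl hc, by simp [hv], fun j hj hcj => ?_⟩
        by_cases hjk : (j : ℕ) = k
        · have : j = ⟨k, hk⟩ := Fin.ext hjk
          rw [this]
        · exact hlt.trans (hle j (by omega) hcj)
      · refine ⟨q, hq, by simp [hv], fun j hj hcj => ?_⟩
        by_cases hjk : (j : ℕ) = k
        · have : j = ⟨k, hk⟩ := Fin.ext hjk
          rw [this] at hcj ⊢
          exact hc hcj
        · exact hle j (by omega) hcj)
  obtain ⟨q, hq, h3, hle⟩ := this
  rw [h.card] at hle
  exact ⟨q, ⟨hq, fun j hj => hle j j.2 hj⟩, h3⟩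

lemma run_secondBody {I : Roommates n} {σ : Equiv.Perm (Fin n)} {s : State} (h : HoldsPerm I σ s)
    {x : Fin n} (h1 : s.var 1 = x) :
    ∃ q : Fin n, I.IsSecond σ x q ∧
      (∀ y, (secondBody.run s).arr 6 y = if y = x then (q : ℕ) else s.arr 6 y) ∧
      ∀ y, (secondBody.run s).arr 7 y = if y = x then ((σ⁻¹ q : Fin n) : ℕ) else s.arr 7 y := by
  set u := (Code.ite (.ne (.read 4 (.var 1)) (.var 1))
        (.assign 4 (.rank (.var 1) (.read 4 (.var 1)))) (.assign 4 (.const 0))).run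
        ((Code.assign 3 (.var 1)).run s) with hu
  have hs : (Expr.read 4 (.var 1)).eval (s.setVar 3 x) = (σ x : Fin n) := by
    simp only [Expr.eval, setVar_var, setVar_arr]
    simp [h1, h.succ]
  have hv : (Expr.var 1).eval (s.setVar 3 x) = x := by
    simp [Expr.eval, setVar_var, h1]
  have hh : HoldsPerm I σ (s.setVar 3 x) := h.congr (by simp [setVar_var]) rfl rfl rfl rfl
  have hu' : u = (s.setVar 3 x).setVar 4 (I.top σ x) := by
    rw [hu]
    simp only [run, Expr.eval_ne]
    have : (Expr.var 1).eval s = x := h1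
    rw [this, hs, hv, hh.eval_rank hv hs]
    by_cases hx : σ x = x
    · simp [hx, top, Expr.eval]
    · simp [hx, top, Fin.val_inj]
  have h1' : u.var 1 = x := by rw [hu']; simp [setVar_var, h1]
  have hpu : HoldsPerm I σ u := by
    rw [hu']; exact h.congr (by simp [setVar_var]) rfl rfl rfl rfl
  obtain ⟨q, hq, h3⟩ := run_bestCand hpu (x := x) h1'
    (by rw [hu']; simp [setVar_var]) (by rw [hu']; simp [setVar_var])
  have hf := frame_run bestCand u
  have e1 : (bestCand.run u).var 1 = x := (hf.var 1 rfl).trans h1'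
  have e5 := (hpu.of_frame hf rfl rfl rfl rfl rfl).pred q
  have e6 : (bestCand.run u).arr 6 = s.arr 6 := by rw [hf.arr 6 rfl, hu']; rfl
  have e7 : (bestCand.run u).arr 7 = s.arr 7 := by rw [hf.arr 7 rfl, hu']; rfl
  have hrun : secondBody.run s = (Code.write 7 (.var 1) (.read 5 (.var 3))).run
    ((Code.write 6 (.var 1) (.var 3)).run (bestCand.run u)) := rfl
  refine ⟨q, hq, fun y => ?_, fun y => ?_⟩
  · rw [hrun]
    simp [run, Expr.eval, setArr_arr, setArr_var, e1, h3, e6]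
  · rw [hrun, ← e5]
    simp [run, Expr.eval, setArr_arr, setArr_var, e1, h3, e7]

lemma run_seconds {I : Roommates n} {σ : Equiv.Perm (Fin n)} {s : State} (h : HoldsPerm I σ s) :
    ∃ f : Fin n → Fin n, (∀ x, I.IsSecond σ x (f x)) ∧
      (∀ x : Fin n, (seconds.run s).arr 6 x = f x) ∧
      ∀ x : Fin n, (seconds.run s).arr 7 x = (σ⁻¹ (f x) : Fin n) := by
  have := run_forLt (x := 1) (C := secondBody) rfl s
    (fun k u => ∀ x : Fin n, (x : ℕ) < k → ∃ q : Fin n, I.IsSecond σ x q ∧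
      u.arr 6 x = q ∧ u.arr 7 x = (σ⁻¹ q : Fin n))
    (fun j hj => absurd hj (by omega)) (by
      intro k hk u hf e0 h1 hinv x hx
      rw [h.card] at hk
      have hu := h.of_frame hf rfl rfl rfl rfl rfl
      obtain ⟨q, hq, h6, h7⟩ := run_secondBody hu (x := ⟨k, hk⟩) h1
      rw [setVar_arr, h6, h7]
      by_cases hxk : (x : ℕ) = k
      · have : x = ⟨k, hk⟩ := Fin.ext hxk
        subst this
        exact ⟨q, hq, by simp, by simp⟩
      · simp only [hxk, if_false]
        exact hinv x (by omega))
  rw [h.card] at this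
  choose f hf using fun x : Fin n => this x x.2
  exact ⟨f, fun x => (hf x).1, fun x => (hf x).2.1, fun x => (hf x).2.2⟩

end Roommates

/-! ### Finding a violating agent and eliminating its rotation. -/

namespace Roommates

open RAM RAM.Code

variable {n : ℕ}

def findBody : Code :=
  .ite (.sub (.rank (.var 1) (.read 5 (.var 1))) (.rank (.var 1) (.read 6 (.var 1))))
    (.assign 3 (.var 1)) .skip

/-- Look for an agent who can be the start of a rotation. -/
def findStart : Code := .forLt 1 findBody

def walkBody : Code := .assign 3 (.read 7 (.var 3))

/-- Walk into the rotation. -/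
def walk : Code := .forLt 1 walkBody

def eliminateBody : Code :=
  .seq (.write 4 (.var 3) (.read 6 (.var 3)))
    (.seq (.write 5 (.read 6 (.var 3)) (.var 3)) (.assign 3 (.read 7 (.var 3))))

/-- Eliminate the rotation. -/
def eliminate : Code := .forLt 1 eliminateBody

/-- The value `n` in variable `3` signals that no violating agent was found. -/
def rotate : Code := .ite (.sub (.var 0) (.var 3)) (.seq walk eliminate) .skip

def round : Code := .seq seconds (.seq (.assign 3 (.var 0)) (.seq findStart rotate))

lemma run_findStart {I : Roommates n} {σ : Equiv.Perm (Fin n)} {f : Fin n → Fin n} {s : State}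
    (h : HoldsPerm I σ s) (h6 : ∀ x : Fin n, s.arr 6 x = f x) (h3 : s.var 3 = n) :
    ((findStart.run s).var 3 = n ∧ ∀ x, I.bot σ x ≤ I.rank x (f x)) ∨
      ∃ x : Fin n, (findStart.run s).var 3 = x ∧ I.rank x (f x) < I.bot σ x := by
  have := run_forLt (x := 1) (C := findBody) rfl s
    (fun k u => (u.var 3 = n ∧ ∀ x : Fin n, (x : ℕ) < k → I.bot σ x ≤ I.rank x (f x)) ∨
      ∃ x : Fin n, u.var 3 = x ∧ I.rank x (f x) < I.bot σ x)
    (Or.inl ⟨by simp [setVar_var, h3], fun j hj => absurd hj (by omega)⟩) (by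
      intro k hk u hf e0 h1 hinv
      rw [h.card] at hk
      have hu := h.of_frame hf rfl rfl rfl rfl rfl
      obtain ⟨x, rfl⟩ : ∃ x : Fin n, k = x := ⟨⟨k, hk⟩, rfl⟩
      have e6 : (Expr.read 6 (.var 1)).eval u = f x := by
        simp only [Expr.eval, h1]; rw [hf.arr 6 rfl, h6]
      have e5 : (Expr.read 5 (.var 1)).eval u = (σ⁻¹ x : Fin n) := by
        simp only [Expr.eval, h1, hu.pred]
      have e1 : (Expr.var 1).eval u = x := h1
      have hrun : findBody.run u = if I.rank x (f x) < I.bot σ x then u.setVar 3 x else u := by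
        simp only [findBody, run, Expr.eval_sub, hu.eval_rank e1 e5, hu.eval_rank e1 e6, e1]
        rfl
      rw [hrun]
      split_ifs with hc
      · exact Or.inr ⟨x, by simp [setVar_var], hc⟩
      · refine hinv.imp (fun ⟨a, b⟩ => ⟨by simp [setVar_var, a], fun y hy => ?_⟩)
          (fun ⟨y, a, b⟩ => ⟨y, by simp [setVar_var, a], b⟩)
        by_cases hyx : y = x
        · rw [hyx]; exact not_lt.1 hc
        · exact b y (by have := Fin.val_injective.ne hyx; omega))
  rw [h.card] at this
  exact this.imp (fun ⟨a, b⟩ => ⟨a, fun x => b x x.2⟩) id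

lemma run_walk {g : Fin n → Fin n} {s : State} (h0 : s.var 0 = n)
    (h7 : ∀ x : Fin n, s.arr 7 x = g x) {x : Fin n} (h3 : s.var 3 = x) :
    (walk.run s).var 3 = g^[n] x := by
  have := run_forLt (x := 1) (C := walkBody) rfl s (fun k u => u.var 3 = g^[k] x)
    (by simp [setVar_var, h3]) (by
      intro k hk u hf e0 h1 hinv
      have e7 : u.arr 7 (g^[k] x) = g (g^[k] x) := by rw [hf.arr 7 rfl, h7]
      rw [Function.iterate_succ_apply']
      simp [walkBody, run, Expr.eval, setVar_var, hinv, e7])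
  rw [h0] at this
  exact this

/-- The `n` steps may go around the rotation several times. This is harmless: arrays `6` and `7`
stay fixed, so every write stores a value of `σ'` or its inverse, and a cell is either final or
still old and unvisited. -/
lemma run_eliminate {I : Roommates n} {σ σ' : Equiv.Perm (Fin n)} {f g : Fin n → Fin n} {s : State}
    (h : HoldsPerm I σ s) (h6 : ∀ x : Fin n, s.arr 6 x = f x) (h7 : ∀ x : Fin n, s.arr 7 x = g x)
    {p : Fin n} (h3 : s.var 3 = p) (hin : ∀ k < n, σ' (g^[k] p) = f (g^[k] p))
    (hout : ∀ y, (∀ k < n, y ≠ g^[k] p) → σ' y = σ y) : HoldsPerm I σ' (eliminate.run s) := by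
  have hfr := frame_run eliminate s
  have := run_forLt (x := 1) (C := eliminateBody) rfl s
    (fun k u => u.var 3 = g^[k] p ∧
      (∀ y : Fin n, u.arr 4 y = σ' y ∨ (u.arr 4 y = σ y ∧ ∀ m < k, y ≠ g^[m] p)) ∧
      ∀ q : Fin n, u.arr 5 q = (σ'⁻¹ q : Fin n) ∨
        (u.arr 5 q = (σ⁻¹ q : Fin n) ∧ ∀ m < k, q ≠ f (g^[m] p)))
    ⟨by simp [setVar_var, h3], fun y => Or.inr ⟨h.succ y, fun m hm => absurd hm (by omega)⟩,
      fun y => Or.inr ⟨h.pred y, fun m hm => absurd hm (by omega)⟩⟩ (by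
      rintro k hk u hf e0 h1 ⟨e3, i4, i5⟩
      rw [h.card] at hk
      have e6 : u.arr 6 (g^[k] p) = f (g^[k] p) := by rw [hf.arr 6 rfl, h6]
      have e7 : u.arr 7 (g^[k] p) = g (g^[k] p) := by rw [hf.arr 7 rfl, h7]
      have hσ' := hin k hk
      have hσi : σ'⁻¹ (f (g^[k] p)) = g^[k] p := by rw [← hσ', perm_inv_apply_self]
      rw [Function.iterate_succ_apply']
      refine ⟨?_, fun y => ?_, fun q => ?_⟩
      · simp [eliminateBody, run, Expr.eval, setVar_var, setArr_var, setArr_arr, e3, e7]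
      · have : ((eliminateBody.run u).setVar 1 (k + 1)).arr 4 y =
            if (y : ℕ) = g^[k] p then (f (g^[k] p) : ℕ) else u.arr 4 y := by
          simp [eliminateBody, run, Expr.eval, setVar_arr, setArr_var, setArr_arr, e3, e6]
        rw [this]
        by_cases hy : y = g^[k] p
        · rw [if_pos (by rw [hy]), hy, hσ']; exact Or.inl rfl
        · rw [if_neg (Fin.val_injective.ne hy)]
          refine (i4 y).imp id (And.imp id fun hm m hmk => ?_)
          by_cases hmk' : m = k
          · rw [hmk']; exact hy
          · exact hm m (by omega)
      · have : ((eliminateBody.run u).setVar 1 (k + 1)).arr 5 q =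
            if (q : ℕ) = f (g^[k] p) then (g^[k] p : ℕ) else u.arr 5 q := by
          simp [eliminateBody, run, Expr.eval, setVar_arr, setArr_var, setArr_arr, e3, e6]
        rw [this]
        by_cases hq : q = f (g^[k] p)
        · rw [if_pos (by rw [hq]), hq, hσi]; exact Or.inl rfl
        · rw [if_neg (Fin.val_injective.ne hq)]
          refine (i5 q).imp id (And.imp id fun hm m hmk => ?_)
          by_cases hmk' : m = k
          · rw [hmk']; exact hq
          · exact hm m (by omega))
  obtain ⟨-, i4, i5⟩ := this
  rw [h.card] at i4 i5
  refine ⟨h.toHoldsRanks.congr (hfr.var 0 rfl) (hfr.arr 2 rfl) (hfr.arr 3 rfl), fun y => ?_,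
    fun q => ?_⟩
  · rcases i4 y with h' | ⟨h', hy⟩
    · exact h'
    · exact h'.trans (by rw [hout y hy])
  · rcases i5 q with h' | ⟨h', hq⟩
    · exact h'
    · refine h'.trans ?_
      -- An unwritten cell of the inverse belongs to a `q` whose preimage under `σ'` is off the
      -- rotation, where `σ'` and `σ` agree.
      have hy : ∀ m < n, σ'⁻¹ q ≠ g^[m] p := by
        intro m hm heq
        apply hq m hm
        rw [← hin m hm, ← heq, perm_apply_inv_self]
      have := hout _ hy
      rw [perm_apply_inv_self] at this
      have h'' : σ⁻¹ q = σ'⁻¹ q := by rw [Equiv.Perm.inv_eq_iff_eq]; exact this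
      rw [h'']

lemma run_round {I : Roommates n} {σ : Equiv.Perm (Fin n)} {s : State} (h : HoldsPerm I σ s)
    (hσ : I.IsSemistable σ) :
    ∃ σ', I.IsSemistable σ' ∧ HoldsPerm I σ' (round.run s) ∧
      ((I.IsStablePartition σ ∧ σ' = σ) ∨
        (¬ I.IsStablePartition σ ∧ ∑ x, I.top σ x < ∑ x, I.top σ' x)) := by
  obtain ⟨f, hf, h6, h7⟩ := run_seconds h
  have hs := frame_run seconds s
  set u := (Code.assign 3 (.var 0)).run (seconds.run s) with hu
  have hu' : u = (seconds.run s).setVar 3 n := by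
    rw [hu, ← h.card, ← hs.var 0 rfl]; rfl
  have hpu : HoldsPerm I σ u := by
    have := h.of_frame hs rfl rfl rfl rfl rfl
    rw [hu']
    exact this.congr (by simp [setVar_var]) rfl rfl rfl rfl
  have u6 : ∀ x : Fin n, u.arr 6 x = f x := by rw [hu']; exact h6
  have u7 : ∀ x : Fin n, u.arr 7 x = (σ⁻¹ (f x) : Fin n) := by rw [hu']; exact h7
  have hv := frame_run findStart u
  have hpv := hpu.of_frame hv rfl rfl rfl rfl rfl
  have hrun : round.run s = rotate.run (findStart.run u) := rfl
  have hif : rotate.run (findStart.run u) = if (findStart.run u).var 3 < n then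
      eliminate.run (walk.run (findStart.run u)) else findStart.run u := by
    simp only [rotate, run, Expr.eval_sub]
    simp only [Expr.eval, hpv.card]
  rw [hrun, hif]
  rcases run_findStart hpu u6 (by rw [hu']; simp [setVar_var]) with ⟨e3, hst⟩ | ⟨x, e3, hx⟩
  · rw [e3, if_neg (lt_irrefl _)]
    exact ⟨σ, hσ, hpv, Or.inl ⟨hσ.isStablePartition hf hst, rfl⟩⟩
  · rw [e3, if_pos x.2]
    obtain ⟨σ', h1, h2, h3, h4⟩ :=
      exists_rotation_elimination hσ hf hx (fun x => σ⁻¹ (f x)) fun _ => rfl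
    refine ⟨σ', h1, ?_, Or.inr ⟨fun hst => ?_, h2⟩⟩
    · set v := findStart.run u with hvdef
      have v6 : ∀ x : Fin n, v.arr 6 x = f x := fun x => by rw [hv.arr 6 rfl, u6]
      have v7 : ∀ x : Fin n, v.arr 7 x = (σ⁻¹ (f x) : Fin n) := fun x => by rw [hv.arr 7 rfl, u7]
      have hw := frame_run walk v
      refine run_eliminate (hpv.of_frame hw rfl rfl rfl rfl rfl) (f := f)
        (g := fun x => σ⁻¹ (f x)) (p := (fun x => σ⁻¹ (f x))^[n] x) (fun x => ?_) (fun x => ?_)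
        (run_walk hpv.card v7 e3) h3 h4
      · rw [hw.arr 6 rfl, v6]
      · rw [hw.arr 7 rfl, v7]
    -- The pair of `x` and its second violates stability, so `σ` was not yet a stable partition.
    · have hne : f x ≠ x := by
        intro heq
        rw [heq, rank_self] at hx
        have := bot_le (I := I) (σ := σ) x
        omega
      have hc := (hf x).isCand hne
      have hlt := hc.2.2
      have hb := bot_le (I := I) (σ := σ) (f x)
      rcases hst.stable x (f x) (I.edge_iff.2 ⟨hc.2.1, by omega⟩) (Or.inr (I.prefers_iff.2 hx))
        with heq | hp
      · rw [bot, heq] at hlt; exact lt_irrefl _ hlt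
      · exact lt_asymm hlt (I.prefers_iff.1 hp)

/-- `n * n` rounds and one more. -/
def rounds : Code := .seq (.forLt 10 (.forLt 11 round)) round

/-- The state holds a permutation that is a stable partition or the result of at least `m`
eliminations. -/
def Progress (I : Roommates n) (m : ℕ) (s : State) : Prop :=
  ∃ σ, I.IsSemistable σ ∧ HoldsPerm I σ s ∧ (I.IsStablePartition σ ∨ m ≤ ∑ x, I.top σ x)

lemma Progress.setVar {I : Roommates n} {m : ℕ} {s : State} (h : Progress I m s) {x : ℕ}
    (hx : x ≠ 0) (v : ℕ) : Progress I m (s.setVar x v) := by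
  obtain ⟨σ, h1, h2, h3⟩ := h
  exact ⟨σ, h1, h2.congr (by rw [setVar_var, if_neg hx.symm]) rfl rfl rfl rfl, h3⟩

lemma Progress.round {I : Roommates n} {m : ℕ} {s : State} (h : Progress I m s) :
    Progress I (m + 1) (round.run s) := by
  obtain ⟨σ, h1, h2, h3⟩ := h
  obtain ⟨σ', k1, k2, ⟨k3, rfl⟩ | ⟨k3, k4⟩⟩ := run_round h2 h1
  · exact ⟨σ', k1, k2, Or.inl k3⟩
  · exact ⟨σ', k1, k2, Or.inr (by have := h3.resolve_left k3; omega)⟩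

/-- Each of the `n` summands is at most `n`, so `n * n + 1` strict increases are impossible; hence
the one extra round. -/
lemma Progress.isStablePartition {I : Roommates n} {s : State} (h : Progress I (n * n + 1) s) :
    ∃ σ, I.IsStablePartition σ ∧ HoldsPerm I σ s := by
  obtain ⟨σ, h1, h2, h3⟩ := h
  refine ⟨σ, h3.resolve_right fun hle => ?_, h2⟩
  have : ∑ x, I.top σ x ≤ ∑ _x : Fin n, n := Finset.sum_le_sum fun x _ => h1.top_le_card x
  simp at this
  omega

lemma run_rounds {I : Roommates n} {s : State} (h : HoldsPerm I 1 s) :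
    ∃ σ, I.IsStablePartition σ ∧ HoldsPerm I σ (rounds.run s) := by
  have hstart : Progress I 0 s := ⟨1, I.isSemistable_one, h, Or.inr (Nat.zero_le _)⟩
  have := run_forLt (x := 10) (C := .forLt 11 round) rfl s (fun k u => Progress I (k * n) u)
    (by rw [zero_mul]; exact hstart.setVar (by decide) _) (by
      intro k hk u hf e0 h1 hinv
      have := run_forLt (x := 11) (C := round) rfl u (fun m v => Progress I (k * n + m) v)
        (hinv.setVar (by decide) _) (by
          intro m hm v hf' e0' h1' hinv'
          exact hinv'.round.setVar (by decide) _)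
      rw [e0, h.card] at this
      rw [add_mul, one_mul]
      exact this.setVar (by decide) _)
  rw [h.card] at this
  exact this.round.isStablePartition

/-! ### The matching -/

def minBody : Code :=
  .seq (.assign 3 (.read 4 (.var 3))) (.ite (.sub (.var 2) (.var 3)) (.assign 2 (.var 3)) .skip)

/-- Variable `2` receives the least vertex of the cycle of the vertex in variable `3`. -/
def cycleMin : Code := .forLt 4 minBody

def parityBody : Code :=
  .ite (.ne (.var 3) (.var 1))
    (.seq (.assign 3 (.read 4 (.var 3))) (.assign 5 (.sub (.const 1) (.var 5)))) .skip

/-- Variable `5` receives the parity of the distance from the vertex in variable `3` to the one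
in variable `1`. -/
def parity : Code := .forLt 4 parityBody

def writePartner : Code :=
  .ite (.var 5) (.write 1 (.var 1) (.read 5 (.var 1)))
    (.ite (.ne (.read 4 (.var 1)) (.var 2)) (.write 1 (.var 1) (.read 4 (.var 1)))
      (.write 1 (.var 1) (.var 1)))

def partnerBody : Code :=
  .seq (.seq (.assign 2 (.var 1)) (.assign 3 (.var 1))) (.seq cycleMin
    (.seq (.seq (.assign 3 (.var 2)) (.assign 5 (.const 0))) (.seq parity writePartner)))

def partners : Code := .forLt 1 partnerBody

lemma run_cycleMin {I : Roommates n} {σ : Equiv.Perm (Fin n)} {s : State} (h : HoldsPerm I σ s)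
    {x : Fin n} (h2 : s.var 2 = x) (h3 : s.var 3 = x) :
    ∃ y : Fin n, (cycleMin.run s).var 2 = y ∧ σ.SameCycle x y ∧ ∀ m ≤ n, y ≤ (σ ^ m) x := by
  have := run_forLt (x := 4) (C := minBody) rfl s
    (fun k u => u.var 3 = ((σ ^ k) x : Fin n) ∧ ∃ y : Fin n, u.var 2 = y ∧ σ.SameCycle x y ∧
      ∀ m ≤ k, y ≤ (σ ^ m) x)
    ⟨by simp [setVar_var, h3], x, by simp [setVar_var, h2], Equiv.Perm.SameCycle.refl σ x, by
      intro m hm; rw [Nat.le_zero.1 hm]; rfl⟩ (by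
      rintro k hk u hf e0 h4 ⟨e3, y, e2, hy, hle⟩
      have hu := h.of_frame hf rfl rfl rfl rfl rfl
      have e4 : u.arr 4 ((σ ^ k) x : Fin n) = ((σ ^ (k + 1)) x : Fin n) := by
        rw [hu.succ, pow_succ', Equiv.Perm.mul_apply]
      set z := (σ ^ (k + 1)) x with hz
      have hzc : σ.SameCycle x z := ⟨(k + 1 : ℕ), by rw [zpow_natCast]⟩
      have hrun : minBody.run u = if z < y then (u.setVar 3 z).setVar 2 z else u.setVar 3 z := by
        simp only [minBody, run, Expr.eval_sub]
        simp [Expr.eval, e3, e4, setVar_var, e2]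
      rw [hrun]
      split_ifs with hlt
      · refine ⟨by simp [setVar_var], z, by simp [setVar_var], hzc, fun m hm => ?_⟩
        rcases Nat.lt_or_ge k m with h' | h'
        · have : m = k + 1 := by omega
          rw [this]
        · exact hlt.le.trans (hle m h')
      · refine ⟨by simp [setVar_var], y, by simp [setVar_var, e2], hy, fun m hm => ?_⟩
        rcases Nat.lt_or_ge k m with h' | h'
        · have : m = k + 1 := by omega
          rw [this, ← hz]; exact not_lt.1 hlt
        · exact hle m h')
  rw [h.card] at this
  exact this.2

/-- The walk stops moving once it has reached its target, so `n` passes serve every distance `d ≤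
n`. -/
lemma run_parity {I : Roommates n} {σ : Equiv.Perm (Fin n)} {s : State} (h : HoldsPerm I σ s)
    {x y : Fin n} (h1 : s.var 1 = x) (h3 : s.var 3 = y) (h5 : s.var 5 = 0) {d : ℕ} (hd : d ≤ n)
    (hpow : (σ ^ d) y = x) (hmin : ∀ m < d, (σ ^ m) y ≠ x) :
    (parity.run s).var 5 = d % 2 := by
  have := run_forLt (x := 4) (C := parityBody) rfl s
    (fun k u => u.var 3 = ((σ ^ (min k d)) y : Fin n) ∧ u.var 5 = min k d % 2)
    (by simp [setVar_var, h3, h5]) (by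
      rintro k hk u hf e0 h4 ⟨e3, e5⟩
      have hu := h.of_frame hf rfl rfl rfl rfl rfl
      have e1 := (hf.var 1 rfl).trans h1
      simp only [parityBody, run, Expr.eval_ne]
      simp only [Expr.eval, e1, e3]
      rcases Nat.lt_or_ge k d with hkd | hkd
      · rw [min_eq_left hkd.le] at e3 e5 ⊢
        rw [min_eq_left (by omega : k + 1 ≤ d)]
        have e4 : u.arr 4 ((σ ^ k) y : Fin n) = ((σ ^ (k + 1)) y : Fin n) := by
          rw [hu.succ, pow_succ', Equiv.Perm.mul_apply]
        rw [if_pos (Fin.val_injective.ne (hmin k hkd))]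
        simp only [setVar_var, e4, e5]
        simp only [Nat.reduceEqDiff, if_true, if_false, true_and]
        omega
      · rw [min_eq_right hkd] at e3 e5 ⊢
        rw [min_eq_right (by omega : d ≤ k + 1), hpow, if_neg (by simp)]
        rw [hpow] at e3
        simp [setVar_var, e3, e5])
  rw [h.card, min_eq_right hd] at this
  exact this.2

lemma run_partnerBody {I : Roommates n} {σ : Equiv.Perm (Fin n)} {b : Fin n → Fin n}
    {d : Fin n → ℕ} {s : State} (h : HoldsPerm I σ s) (hb : IsCut σ b d)
    (hmin : ∀ x y, σ.SameCycle x y → b x ≤ y) {x : Fin n} (h1 : s.var 1 = x) (j : ℕ) :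
    (partnerBody.run s).arr 1 j = if j = x then (pairUp σ b d x : ℕ) else s.arr 1 j := by
  -- Cycles have at most `n` vertices, so loops of `n` steps see the whole cycle.
  have hex : ∀ y z, σ.SameCycle y z → ∃ m ≤ n, (σ ^ m) y = z := by
    intro y z hyz
    by_cases hy : σ y = y
    · exact ⟨0, Nat.zero_le _, (hyz.eq_of_left hy)⟩
    · obtain ⟨m, hm, h⟩ := hyz.exists_pow_eq_of_mem_support (Equiv.Perm.mem_support.2 hy)
      have := Finset.card_le_univ (σ.cycleOf y).support
      rw [Fintype.card_fin] at this
      exact ⟨m, by omega, h⟩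
  have hdn : d x ≤ n := by
    obtain ⟨m, hm, hmx⟩ := hex _ _ (hb.sameCycle x)
    by_contra! hlt
    exact hb.min x m (by omega) hmx
  set u := (s.setVar 2 x).setVar 3 x with hu
  have hpu : HoldsPerm I σ u := h.congr (by simp [hu, setVar_var]) rfl rfl rfl rfl
  obtain ⟨y, hy2, hxy, hle⟩ := run_cycleMin hpu (x := x) (by simp [hu, setVar_var])
    (by simp [hu, setVar_var])
  have hyb : y = b x := by
    apply le_antisymm
    · obtain ⟨m, hm, hmx⟩ := hex _ _ (hb.sameCycle x).symm
      rw [← hmx]; exact hle m hm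
    · exact hmin x y hxy
  subst hyb
  have hfu := frame_run cycleMin u
  set v := ((cycleMin.run u).setVar 3 (b x)).setVar 5 0 with hv
  have hpv : HoldsPerm I σ v :=
    (hpu.of_frame hfu rfl rfl rfl rfl rfl).congr (by simp [hv, setVar_var]) rfl rfl rfl rfl
  have v1 : v.var 1 = x := by
    have h2 : (cycleMin.run u).var 1 = u.var 1 := hfu.var 1 rfl
    have h3 : u.var 1 = x := by simp [hu, setVar_var, h1]
    simp [hv, setVar_var, h2, h3]
  have v2 : v.var 2 = b x := by simp [hv, setVar_var, hy2]
  have v5 := run_parity hpv v1 (y := b x) (by simp [hv, setVar_var]) (by simp [hv, setVar_var])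
    hdn (hb.pow x) (hb.min x)
  have hfv := frame_run parity v
  have hpw := hpv.of_frame hfv rfl rfl rfl rfl rfl
  set w := parity.run v with hw
  have w1 : w.var 1 = x := (hfv.var 1 rfl).trans v1
  have w2 : w.var 2 = b x := (hfv.var 2 rfl).trans v2
  have wa : w.arr 1 = s.arr 1 := by
    rw [hfv.arr 1 rfl, hv, setVar_arr, setVar_arr, hfu.arr 1 rfl]; rfl
  have hrun : partnerBody.run s = writePartner.run w := by
    have e1 : ((Code.assign 2 (.var 1)).seq (.assign 3 (.var 1))).run s = u := by
      simp [run, Expr.eval, hu, h1, setVar_var]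
    have e2 : ((Code.assign 3 (.var 2)).seq (.assign 5 (.const 0))).run (cycleMin.run u) = v := by
      simp [run, Expr.eval, hv, hy2]
    simp only [partnerBody, run] at e1 e2 ⊢
    rw [e1, e2]
  rw [hrun]
  simp only [writePartner, run, Expr.eval_ne]
  simp only [Expr.eval, w1, w2, v5, hpw.succ, hpw.pred]
  unfold pairUp
  rcases Nat.mod_two_eq_zero_or_one (d x) with hd | hd
  · have ho : ¬ Odd (d x) := by rw [Nat.odd_iff]; omega
    by_cases hbx : σ x = b x
    · simp [hd, ho, hbx, setArr_arr, wa]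
    · simp [hd, ho, hbx, Fin.val_inj, setArr_arr, wa]
  · have ho : Odd (d x) := by rw [Nat.odd_iff]; omega
    simp [hd, ho, setArr_arr, wa]

lemma run_partners {I : Roommates n} {σ : Equiv.Perm (Fin n)} {b : Fin n → Fin n}
    {d : Fin n → ℕ} {s : State} (h : HoldsPerm I σ s) (hb : IsCut σ b d)
    (hmin : ∀ x y, σ.SameCycle x y → b x ≤ y) (x : Fin n) :
    (partners.run s).arr 1 x = pairUp σ b d x := by
  have := run_forLt (x := 1) (C := partnerBody) rfl s
    (fun k u => ∀ x : Fin n, (x : ℕ) < k → u.arr 1 x = pairUp σ b d x)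
    (fun j hj => absurd hj (by omega)) (by
      intro k hk u hf e0 h1 hinv x hx
      rw [h.card] at hk
      rw [setVar_arr, run_partnerBody (h.of_frame hf rfl rfl rfl rfl rfl) hb hmin (x := ⟨k, hk⟩) h1]
      by_cases hxk : (x : ℕ) = k
      · subst hxk; simp
      · rw [if_neg hxk]
        exact hinv x (by omega))
  rw [h.card] at this
  exact this x x.2

/-- The cut of every cycle at its least vertex. -/
lemma exists_isCut_min (σ : Equiv.Perm (Fin n)) :
    ∃ b d, IsCut σ b d ∧ ∀ x y, σ.SameCycle x y → b x ≤ y := by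
  classical
  let S := Equiv.Perm.SameCycle.setoid σ
  have hc : ∀ q : Quotient S, ∃ y : Fin n, Quotient.mk S y = q ∧
      ∀ z, Quotient.mk S z = q → y ≤ z := by
    intro q
    have hne : (Finset.univ.filter fun y => Quotient.mk S y = q).Nonempty :=
      ⟨q.out, by simp⟩
    refine ⟨Finset.min' _ hne, (Finset.mem_filter.1 (Finset.min'_mem _ hne)).2, fun z hz => ?_⟩
    exact Finset.min'_le _ _ (by simpa using hz)
  choose c hc1 hc2 using hc
  obtain ⟨d, hd⟩ := exists_isCut σ c hc1
  exact ⟨_, d, hd, fun x y hxy => hc2 _ y (Quotient.sound hxy.symm)⟩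

/-- The whole algorithm. -/
def algorithm : Code :=
  .seq (.assign 2 (.const 0))
    (.seq rows (.seq rankTable (.seq initPerm (.seq rounds partners))))

/-- The machine cuts cycles at their least vertices; `D` consists of the last vertices of the
resulting odd paths and is never computed. -/
lemma run_algorithm (I : Roommates n) :
    ∃ (M : I.Matching) (π : Equiv.Perm (Fin n)) (D : Finset (Fin n)),
      Outputs (algorithm.run I.inputState) M ∧ I.IsStablePartition π ∧
        PicksOnePerOddCycle π D ∧ I.IsObtainedFrom π D M := by
  set s := I.inputState.setVar 2 0 with hs
  have s0 : s.var 0 = n := by simp [hs, setVar_var, inputState]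
  have hf := frame_run rows s
  have h1 := run_rows I.inputState
  have h2 := run_rankTable I (rows.run s) ((hf.var 0 rfl).trans s0) ((hf.arr 0 rfl).trans rfl)
    (fun i => h1 i i.2)
  obtain ⟨π, hπ, h3⟩ := run_rounds (run_initPerm h2)
  obtain ⟨b, d, hb, hmin⟩ := exists_isCut_min π
  obtain ⟨D, hD, hDb⟩ := hb.exists_picks
  exact ⟨hb.matching hπ, π, D, run_partners h3 hb hmin, hπ, hD, hb.isObtainedFrom hπ hD hDb⟩

end Roommates

theorem mainTheorem4 :
    -- a `cn`-stable matching exists for every `c > 5/6`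
    (∀ (n : ℕ) (I : Roommates n) (c : ℝ), 5 / 6 < c →
      ∃ M : I.Matching, I.IsKStable (c * n) M) ∧
    -- the construction can always be carried out ...
    (∀ (n : ℕ) (I : Roommates n), ∃ π : Equiv.Perm (Fin n), I.IsStablePartition π) ∧
    (∀ (n : ℕ) (I : Roommates n) (π : Equiv.Perm (Fin n)), I.IsStablePartition π →
      (∃ D : Finset (Fin n), Roommates.PicksOnePerOddCycle π D) ∧
      ∀ D : Finset (Fin n), Roommates.PicksOnePerOddCycle π D →
        (∃ M : I.Matching, I.IsObtainedFrom π D M) ∧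
        -- ... and at most `n/2 + x ≤ 5n/6` agents can improve on the matching that it gives
        ∀ M : I.Matching, I.IsObtainedFrom π D M →
          (∀ M' : I.Matching, ((I.improving M M').card : ℝ) ≤
            (n : ℝ) / 2 + ((Roommates.oddCycles π).card : ℝ)) ∧
          (n : ℝ) / 2 + ((Roommates.oddCycles π).card : ℝ) ≤ 5 * (n : ℝ) / 6 ∧
          ∀ c : ℝ, 5 / 6 < c → I.IsKStable (c * n) M) ∧
    -- one polynomial-time algorithm finds such a matching, which is good for all `c > 5/6`
    (∃ (P : RAM.Prog) (p : Polynomial ℕ), ∀ (n : ℕ) (I : Roommates n),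
      ∃ (M : I.Matching) (t : ℕ) (s : RAM.State),
        RAM.Exec P I.inputState t s ∧ t ≤ p.eval n ∧ Roommates.Outputs s M ∧
        (∃ (π : Equiv.Perm (Fin n)) (D : Finset (Fin n)), I.IsStablePartition π ∧
          Roommates.PicksOnePerOddCycle π D ∧ I.IsObtainedFrom π D M) ∧
        ∀ c : ℝ, 5 / 6 < c → I.IsKStable (c * n) M) := by
  refine ⟨fun n I c hc => ?_, fun n I => ?_, fun n I π hπ => ⟨?_, fun D hD => ⟨?_, fun M hM =>
    ⟨?_, ?_, fun c hc => ?_⟩⟩⟩, ?_⟩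
  -- Both existence claims come from the correctness of the algorithm.
  · obtain ⟨M, π, D, -, hπ, hD, hM⟩ := I.run_algorithm
    exact ⟨M, hM.isKStable hπ hD hc⟩
  · obtain ⟨M, π, D, -, hπ, -⟩ := I.run_algorithm
    exact ⟨π, hπ⟩
  · exact Roommates.exists_picksOnePerOddCycle π
  · exact Roommates.exists_isObtainedFrom hπ hD
  · exact hM.card_improving_le_half hπ hD
  · exact Roommates.card_half_add_le π
  · exact hM.isKStable hπ hD hc
  · refine ⟨Roommates.algorithm.compile, Roommates.algorithm.time, fun n I => ?_⟩
    obtain ⟨M, π, D, hout, hπ, hD, hM⟩ := I.run_algorithm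
    obtain ⟨t, h1, h2⟩ := RAM.Code.exec_compile (C := Roommates.algorithm) rfl I.inputState
    exact ⟨M, t, _, h1, h2, hout, ⟨π, D, hπ, hD, hM⟩, fun c hc => hM.isKStable hπ hD hc⟩
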